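/- **Conventions.** Let $\theta\ge 0$. *Virtual permutations.* $\Sigma_N$ is the symmetric group on $\{1,\dots,N\}$. A virtual permutation is a sequence $(\sigma_N)_{N\ge1}$, $\sigma_N\in\Sigma_N$, such that for every $N$ the cycle structure of $\sigma_N$ is obtained from that of $\sigma_{N+1}$ by removing the letter $N+1$ from its cycle. The set $\Sigma_\infty$ of virtual permutations carries the $\sigma$-algebra generated by the coordinates. For $m_j\in\{1,\dots,j\}$ let $\Phi_\infty((m_j)_{j\ge1})=(\sigma_N)_{N\ge1}$ with $\sigma_N=\tau_{N,m_N}\circ\cdots\circ\tau_{1,m_1}$, where $\tau_{j,k}$ exchanges $j$ and $k$ (and is the identity if $j=k$). The Ewens measure of parameter $\theta$ on $\Sigma_\infty$ is the law of $\Phi_\infty((M_j)_{j\ge1})$, where the $M_j\in\{1,\dots,j\}$ are independent, $M_1=1$, and for $j\ge2$, $\mathbb P[M_j=j]=\frac{\theta}{\theta+j-1}$ and $\mathbb P[M_j=k]=\frac1{\theta+j-1}$ for $k<j$. *Poisson–Dirichlet distribution.* For $\theta>0$ it is the law of the decreasing rearrangement of $\big(V_i\prod_{j<i}(1-V_j)\big)_{i\ge1}$,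 where $(V_i)_{i\geq 1}$ are i.i.d. with density $\theta(1-t)^{\theta-1}$ on $(0,1)$; for $\theta=0$ it is the Dirac mass at $(1,0,0,\dots)$. *Circles.* For a decreasing sequence $\lambda=(\lambda_j)_{j\ge1}$ in $\mathbb R_+$, $E(\lambda)$ is the disjoint union of circles $C_j$ of perimeter $\lambda_j$, over the indices $j$ with $\lambda_j>0$, with its Lebesgue (arc length) measure. For a sequence $x=(x_k)_{k\ge1}$ of distinct points of $E(\lambda)$, $\sigma_\infty(\lambda,x)=(\sigma_N(\lambda,x))_{N\ge1}$ is the virtual permutation such that, for $k\le N$, $\sigma_N(\lambda,x)(k)$ is the index of the first point of $\{x_1,\dots,x_N\}$ met after leaving $x_k$ when following the circle of $x_k$ counterclockwise (it is $k$ itself if no other of these points is on that circle). **Proposition 2.1.** Let the random sequence $\lambda$ follow the Poisson–Dirichlet distribution of parameter $\theta$. Suppose that, conditionally on $\lambda$, the points $(x_k)_{k\ge1}$ are i.i.d. with a distribution $\kappa_\lambda$ such that, almost surely, $\kappa_\lambda$ is absolutely continuous with respect to Lebesgue measure on $E(\lambda)$ and gives mass $\kappa_\lambda(C_j)=\lambda_j$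 to $C_j$ for every $j$ with $\lambda_j>0$ (for example, $\kappa_\lambda$ may be the uniform distribution on $E(\lambda)$, whose total length is almost surely $1$). Then almost surely the points $x_k$ are distinct points of $E(\lambda)$, and the virtual permutation $\sigma_\infty(\lambda,x)$ follows the Ewens measure of parameter $\theta$. -/

import Mathlib

open MeasureTheory ProbabilityTheory
open scoped ENNReal NNReal

noncomputable section

/-! ### Virtual permutations

The symmetric group on `N` letters is `Equiv.Perm (Fin N)`; the letter `k + 1` of the usual notation
is `k : Fin N`, so the letter `N + 1` is `Fin.last N : Fin (N + 1)`. The index `N = 0` is allowed and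
carries no information. -/

/-- Remove the last letter from the cycle containing it:
`k` is sent to `σ k`, unless `σ k` is the last letter, in which case `k` is sent to `σ (σ k)`. -/
def removeLast {N : ℕ} (σ : Equiv.Perm (Fin (N + 1))) : Equiv.Perm (Fin N) :=
  Equiv.removeNone (finSuccEquivLast.permCongr σ)

theorem castSucc_removeLast {N : ℕ} (σ : Equiv.Perm (Fin (N + 1))) (k : Fin N) :
    (removeLast σ k).castSucc =
      if σ k.castSucc = Fin.last N then σ (Fin.last N) else σ k.castSucc := by
  apply finSuccEquivLast.injective
  rw [finSuccEquivLast_castSucc]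
  have h0 : (finSuccEquivLast.permCongr σ) (some k) = finSuccEquivLast (σ k.castSucc) := by
    simp [Equiv.permCongr_apply]
  have h1 : (finSuccEquivLast.permCongr σ) none = finSuccEquivLast (σ (Fin.last N)) := by
    simp [Equiv.permCongr_apply]
  split_ifs with h
  · rw [← h1]
    exact Equiv.removeNone_none _ (by rw [h0, h, finSuccEquivLast_last])
  · rw [← h0]
    refine Equiv.removeNone_some _ ?_
    obtain ⟨y, hy⟩ := Fin.exists_castSucc_eq.mpr h
    exact ⟨y, by rw [h0, ← hy, finSuccEquivLast_castSucc]⟩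

/-- Regard a permutation of the first `N` letters as a permutation of the first `N + 1` letters
fixing the last one. -/
def extendLast {N : ℕ} (σ : Equiv.Perm (Fin N)) : Equiv.Perm (Fin (N + 1)) :=
  finSuccEquivLast.symm.permCongr (Equiv.optionCongr σ)

/-- A virtual permutation: a sequence of permutations `σ N` of `N` letters such that `σ N` is
obtained from `σ (N + 1)` by removing the last letter from its cycle. -/
abbrev VirtualPermutation : Type :=
  {σ : (N : ℕ) → Equiv.Perm (Fin N) // ∀ N, removeLast (σ (N + 1)) = σ N}

/-- Finite symmetric groups carry the discrete σ-algebra; virtual permutations then carry the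
σ-algebra generated by the coordinates `σ ↦ σ N`. -/
instance instMeasurableSpacePermFin (N : ℕ) : MeasurableSpace (Equiv.Perm (Fin N)) := ⊤

instance instDiscretePermFin (N : ℕ) : DiscreteMeasurableSpace (Equiv.Perm (Fin N)) :=
  ⟨fun _ => trivial⟩

/-- The permutation `τ_{N, m_N} ∘ ⋯ ∘ τ_{1, m_1}`, where `τ_{j, m_j}` exchanges the letters `j` and
`m_j ≤ j` (it is the identity if they are equal). -/
def chinesePerm (m : (j : ℕ) → Fin (j + 1)) : (N : ℕ) → Equiv.Perm (Fin N)
  | 0 => 1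
  | N + 1 => Equiv.swap (Fin.last N) (m N) * extendLast (chinesePerm m N)

theorem removeLast_swap_mul {N : ℕ} (a : Fin (N + 1)) (σ : Equiv.Perm (Fin N)) :
    removeLast (Equiv.swap (Fin.last N) a * extendLast σ) = σ := by
  have h : finSuccEquivLast.permCongr (Equiv.swap (Fin.last N) a * extendLast σ)
      = Equiv.Perm.decomposeOption.symm (finSuccEquivLast a, σ) := by
    ext1 x
    have hs : ∀ y, finSuccEquivLast (Equiv.swap (Fin.last N) a y)
        = Equiv.swap none (finSuccEquivLast a) (finSuccEquivLast y) := by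
      intro y
      have h0 : finSuccEquivLast (Fin.last N) = none := by simp
      rw [← h0, finSuccEquivLast.injective.map_swap]
    simp [extendLast, Equiv.permCongr_apply, hs]
  rw [removeLast, h]
  have := congrArg Prod.snd
    (Equiv.Perm.decomposeOption.apply_symm_apply (finSuccEquivLast a, σ))
  simpa [Equiv.Perm.decomposeOption] using this

/-- The virtual permutation with parameters `(m_j)`. -/
def chineseVirtual (m : (j : ℕ) → Fin (j + 1)) : VirtualPermutation :=
  ⟨chinesePerm m, fun N => removeLast_swap_mul (m N) (chinesePerm m N)⟩

/-! ### The Ewens measure on virtual permutations -/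

/-- The law of the `(j + 1)`-st parameter, a letter among the first `j + 1` letters: it is
`Fin.last j` with probability `θ / (θ + j)` and any given other letter with probability
`1 / (θ + j)`. For `j = 0` there is only one letter (this matters only for `θ = 0`). -/
def ewensStep (θ : ℝ≥0) : (j : ℕ) → PMF (Fin (j + 1))
  | 0 => PMF.pure 0
  | j + 1 => PMF.ofFintype
      (fun k => (((if k = Fin.last (j + 1) then θ else 1) / (θ + ((j + 1 : ℕ) : ℝ≥0)) : ℝ≥0) : ℝ≥0∞))
      (by
        rw [← ENNReal.ofNNReal_finsetSum, ← Finset.sum_div, Fin.sum_univ_castSucc]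
        have h : ∀ i : Fin (j + 1), (Fin.castSucc i = Fin.last (j + 1)) = False :=
          fun i => eq_false (Fin.castSucc_lt_last i).ne
        simp only [h, if_true, if_false, Finset.sum_const, Finset.card_univ, Fintype.card_fin,
          nsmul_eq_mul, mul_one]
        rw [add_comm, div_self (by positivity), ENNReal.coe_one])

/-- The Ewens measure of parameter `θ ≥ 0` on virtual permutations: the law of the virtual
permutation whose parameters are independent with laws `ewensStep θ j`. -/
def ewensMeasure (θ : ℝ≥0) : Measure VirtualPermutation :=
  (Measure.infinitePi fun j => (ewensStep θ j).toMeasure).map chineseVirtual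

theorem measurable_chinesePerm (N : ℕ) : Measurable fun m => chinesePerm m N := by
  induction N with
  | zero => exact measurable_const
  | succ N ih =>
    have h1 : Measurable fun m : (j : ℕ) → Fin (j + 1) => m N := measurable_pi_apply N
    have h : Measurable (Function.uncurry fun (a : Fin (N + 1)) (σ : Equiv.Perm (Fin N)) =>
        Equiv.swap (Fin.last N) a * extendLast σ) := .of_discrete
    have h2 := h.comp (h1.prodMk ih)
    simpa only [chinesePerm, Function.comp_def, Function.uncurry] using h2

theorem measurable_chineseVirtual : Measurable chineseVirtual :=
  (measurable_pi_lambda _ measurable_chinesePerm).subtype_mk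

/-! ### The Poisson–Dirichlet distribution -/

/-- Stick breaking: `v_i ∏_{j < i} (1 - v_j)`. -/
def stickBreaking (v : ℕ → ℝ) (i : ℕ) : ℝ := v i * ∏ j ∈ Finset.range i, (1 - v j)

/-- The GEM distribution of parameter `θ > 0`: stick breaking with i.i.d. Beta(1, θ) variables,
i.e. variables with density `θ (1 - t) ^ (θ - 1)` on `(0, 1)`. -/
def gemMeasure (θ : ℝ) : Measure (ℕ → ℝ) :=
  (Measure.infinitePi fun _ : ℕ => betaMeasure 1 θ).map stickBreaking

/-- Decreasing rearrangement of a sequence of nonnegative numbers tending to zero: the entry of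
index `k` is the `(k + 1)`-st largest entry, counted with multiplicity, of the sequence. -/
def decreasingRearrangement (a : ℕ → ℝ) (k : ℕ) : ℝ :=
  ⨆ s : {s : Finset ℕ // s.card = k + 1},
    s.1.inf' (Finset.card_pos.mp (by rw [s.2]; exact Nat.succ_pos k)) a

/-- The Poisson–Dirichlet distribution of parameter `θ`: the law of the decreasing rearrangement
of a GEM(θ) sequence if `θ > 0`, the Dirac mass at `(1, 0, 0, …)` if `θ = 0`. -/
def poissonDirichlet (θ : ℝ≥0) : Measure (ℕ → ℝ) :=
  if θ = 0 then Measure.dirac (Pi.single 0 1)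
  else (gemMeasure θ).map decreasingRearrangement

theorem measurable_stickBreaking : Measurable stickBreaking := by
  refine measurable_pi_lambda _ fun i => ?_
  unfold stickBreaking
  fun_prop

theorem measurable_decreasingRearrangement : Measurable decreasingRearrangement := by
  refine measurable_pi_lambda _ fun k => ?_
  refine Measurable.iSup fun s => ?_
  have hs : s.1.Nonempty := Finset.card_pos.mp (by rw [s.2]; exact Nat.succ_pos k)
  have h : Measurable (s.1.inf' hs fun (i : ℕ) (a : ℕ → ℝ) => a i) :=
    Finset.inf'_induction hs _ (fun _ h1 _ h2 => h1.inf h2) fun i _ => measurable_pi_apply i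
  have e : (s.1.inf' hs fun (i : ℕ) (a : ℕ → ℝ) => a i) = fun a => s.1.inf' hs a := by
    ext a
    exact Finset.inf'_apply hs _ a
  rw [e] at h
  exact h

/-! ### Circles, and the virtual permutation of a sequence of points on circles

The circle of index `j` and perimeter `l j > 0` is `{j} × [0, l j)`: its points are given by their
counterclockwise arc length from an origin. It is absent if `l j = 0`. -/

/-- The circle of index `j`, of perimeter `l j`. -/
def circleSet (l : ℕ → ℝ) (j : ℕ) : Set (ℕ × ℝ) := {j} ×ˢ Set.Ico 0 (l j)

/-- The disjoint union of the circles of perimeters `l 0, l 1, …`. -/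
def circleUnion (l : ℕ → ℝ) : Set (ℕ × ℝ) := {p | 0 ≤ p.2 ∧ p.2 < l p.1}

/-- Lebesgue (arc length) measure on the disjoint union of the circles. -/
def circleLebesgue (l : ℕ → ℝ) : Measure (ℕ × ℝ) :=
  (Measure.count.prod volume).restrict (circleUnion l)

/-- The length of the arc travelled counterclockwise, on a circle of perimeter `ℓ`, from `s` to the
first visit of `t` after the departure (a full turn if `s = t`). -/
def arcLength (ℓ s t : ℝ) : ℝ := if s < t then t - s else t - s + ℓ

/-- The points `x 0, x 1, …` are distinct and lie on the circles of perimeters `l 0, l 1, …`. -/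
structure DistinctOnCircles (l : ℕ → ℝ) (x : ℕ → ℕ × ℝ) : Prop where
  mem : ∀ k, x k ∈ circleUnion l
  injective : Function.Injective x

/-- Following its circle counterclockwise from `x k`, the first of the points
`x 0, …, x (N - 1)` met after the departure is `x m`. -/
def IsNextPoint (l : ℕ → ℝ) (x : ℕ → ℕ × ℝ) {N : ℕ} (k m : Fin N) : Prop :=
  (x m).1 = (x k).1 ∧ ∀ i : Fin N, (x i).1 = (x k).1 →
    arcLength (l (x k).1) (x k).2 (x m).2 ≤ arcLength (l (x k).1) (x k).2 (x i).2

theorem exists_isNextPoint (l : ℕ → ℝ) (x : ℕ → ℕ × ℝ) {N : ℕ} (k : Fin N) :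
    ∃ m, IsNextPoint l x k m := by
  obtain ⟨m, hm, hmin⟩ := Finset.exists_min_image
    (Finset.univ.filter fun i : Fin N => (x i).1 = (x k).1)
    (fun i => arcLength (l (x k).1) (x k).2 (x i).2) ⟨k, by simp⟩
  exact ⟨m, by simpa using hm, fun i hi => hmin i (by simpa using hi)⟩

namespace DistinctOnCircles

variable {l : ℕ → ℝ} {x : ℕ → ℕ × ℝ}

theorem ext_snd (h : DistinctOnCircles l x) {N : ℕ} {i j : Fin N} (h1 : (x i).1 = (x j).1)
    (h2 : (x i).2 = (x j).2) : i = j :=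
  Fin.ext (h.injective (Prod.ext h1 h2))

theorem isNextPoint_unique (h : DistinctOnCircles l x) {N : ℕ} {k m m' : Fin N}
    (hm : IsNextPoint l x k m) (hm' : IsNextPoint l x k m') : m = m' := by
  obtain ⟨h1, h2⟩ := hm
  obtain ⟨h1', h2'⟩ := hm'
  refine h.ext_snd (h1.trans h1'.symm) ?_
  have e := le_antisymm (h2 m' h1') (h2' m h1)
  obtain ⟨a, b⟩ := h.mem m
  obtain ⟨a', b'⟩ := h.mem m'
  rw [h1] at b
  rw [h1'] at b'
  unfold arcLength at e
  split_ifs at e <;> linarith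

theorem isNextPoint_injective (h : DistinctOnCircles l x) {N : ℕ} {k k' m : Fin N}
    (hk : IsNextPoint l x k m) (hk' : IsNextPoint l x k' m) : k = k' := by
  obtain ⟨h1, h2⟩ := hk
  obtain ⟨h1', h2'⟩ := hk'
  have hc : (x k).1 = (x k').1 := h1.symm.trans h1'
  refine h.ext_snd hc ?_
  have e := h2 k' hc.symm
  have e' := h2' k hc
  obtain ⟨a, b⟩ := h.mem m
  obtain ⟨a1, b1⟩ := h.mem k
  obtain ⟨a2, b2⟩ := h.mem k'
  rw [h1'] at b
  rw [hc] at b1 e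
  unfold arcLength at e e'
  split_ifs at e e' <;> linarith

/-- The permutation of `N` letters which sends `k` to the index of the first point among
`x 0, …, x (N - 1)` met after `x k`, following the circle of `x k` counterclockwise. -/
def perm (h : DistinctOnCircles l x) (N : ℕ) : Equiv.Perm (Fin N) :=
  Equiv.ofBijective (fun k => (exists_isNextPoint l x k).choose)
    (Finite.injective_iff_bijective.mp fun k k' hkk' =>
      h.isNextPoint_injective (exists_isNextPoint l x k).choose_spec
        (by rw [show (exists_isNextPoint l x k).choose = (exists_isNextPoint l x k').choose
              from hkk']
            exact (exists_isNextPoint l x k').choose_spec))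

theorem isNextPoint_perm (h : DistinctOnCircles l x) {N : ℕ} (k : Fin N) :
    IsNextPoint l x k (h.perm N k) :=
  (exists_isNextPoint l x k).choose_spec

theorem removeLast_perm (h : DistinctOnCircles l x) (N : ℕ) :
    removeLast (h.perm (N + 1)) = h.perm N := by
  ext1 k
  refine h.isNextPoint_unique ?_ (h.isNextPoint_perm k)
  have hr := castSucc_removeLast (h.perm (N + 1)) k
  have hk := h.isNextPoint_perm (N := N + 1) k.castSucc
  have hL := h.isNextPoint_perm (N := N + 1) (Fin.last N)
  have hval : x (removeLast (h.perm (N + 1)) k) = x (removeLast (h.perm (N + 1)) k).castSucc := rfl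
  rw [IsNextPoint, hval, hr]
  split_ifs with hlast
  · rw [hlast] at hk
    obtain ⟨c1, d1⟩ := hk
    obtain ⟨c2, d2⟩ := hL
    simp only [Fin.val_castSucc] at c1 d1
    refine ⟨c2.trans c1, fun i hi => ?_⟩
    have e1 := d1 i.castSucc hi
    have e2 := d2 i.castSucc (hi.trans c1.symm)
    have hne : (x (Fin.last N)).2 ≠ (x i).2 := fun hc =>
      (Fin.castSucc_lt_last i).ne' (h.ext_snd (c1.trans hi.symm) hc)
    obtain ⟨a0, b0⟩ := h.mem k
    obtain ⟨a1, b1⟩ := h.mem (Fin.last N)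
    obtain ⟨a2, b2⟩ := h.mem (h.perm (N + 1) (Fin.last N))
    obtain ⟨a3, b3⟩ := h.mem i
    rw [c1] at b1 e2 c2
    rw [c2] at b2
    rw [hi] at b3
    simp only [Fin.val_castSucc] at e1 e2
    generalize l (x k).1 = p at *
    unfold arcLength at *
    rcases lt_or_gt_of_ne hne with hlt | hlt <;> split_ifs at e1 e2 ⊢ <;> linarith
  · exact ⟨hk.1, fun i hi => hk.2 i.castSucc hi⟩

end DistinctOnCircles

open Classical in
/-- The virtual permutation defined by a sequence of distinct points on circles (by convention the
sequence of identities, if the points are not distinct or do not all lie on the circles). -/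
def circleVirtual (l : ℕ → ℝ) (x : ℕ → ℕ × ℝ) : VirtualPermutation :=
  if h : DistinctOnCircles l x then ⟨h.perm, h.removeLast_perm⟩ else chineseVirtual Fin.last

/-! ### Conditionally i.i.d. sequences -/

/-- Conditionally on `Y`, the sequence `X` is i.i.d. with law `κ Y`: for measurable sets
`B 0, …, B (N - 1)`, the conditional probability given `Y` that `X k ∈ B k` for all `k < N` is
`∏ k, κ Y (B k)`. -/
def IsCondIID {Ω S T : Type*} [MeasurableSpace Ω] [MeasurableSpace S] [MeasurableSpace T]
    (P : Measure Ω) (Y : Ω → S) (X : Ω → ℕ → T) (κ : Kernel S T) : Prop :=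
  ∀ (A : Set S) (N : ℕ) (B : Fin N → Set T), MeasurableSet A → (∀ k, MeasurableSet (B k)) →
    P {ω | Y ω ∈ A ∧ ∀ k : Fin N, X ω k ∈ B k} = ∫⁻ ω in Y ⁻¹' A, ∏ k, κ (Y ω) (B k) ∂P

end

/-! A virtual permutation is determined by its parameters, the images of the successive last
letters, and its law is determined by the probabilities that `σ N` is a given permutation
(`hasLaw_ewensMeasure_of_chinesePerm`). So it suffices to compute these on both sides. Let σ have k
cycles, of sizes n_q, on N ≥ 1 letters. Under the Ewens measure its probability is θ^(k-1) /
((θ+1)⋯(θ+N-1)): each new cycle after the first costs a factor θ (`prod_ewensStep`).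

On the circles, fix λ. The cycles of σ must occupy distinct circles j_q, and the points fall there
with probability ∏ λ_{j_q}^{n_q}. As the points are exchangeable and almost surely distinct, the ∏
(n_q-1)! cyclic arrangements compatible with this placement are equally likely
(`measure_arrangementEvent`). Summing over placements, the conditional probability of σ is
`distinctSum`, the sum of ∏ λ_{j_q}^{n_q} over distinct j_q, divided by ∏ (n_q-1)!
(`measure_isNextPoint_chinesePerm`). Only the masses of the circles and the absence of atoms are
used, so the points need not be uniform.

It remains to average over λ. The sum over distinct indices does not see the order of the sequence,
so for θ > 0 the decreasing rearrangement can be dropped and λ replaced by stick breaking. That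
sequence is self-similar: a first stick V, then 1-V times an independent copy of the sequence.
Splitting according to which cycle, if any, uses the first stick gives a linear recursion with Beta
integrals as coefficients, whose solution is explicit (`gemMoment_eq`). The average is θ^(k-1) ∏
(n_q-1)! / ((θ+1)⋯(θ+N-1)), also for θ = 0 (`lintegral_distinctSum_poissonDirichlet`), and the
factorials cancel. -/

noncomputable section

/-! ### Sums over distinct indices -/

section DistinctSum

variable {ι : Type*}

open Classical in
/-- The sum of `∏ i ∈ s, w (j i) ^ n i` over all families `j` of distinct indices. -/
def distinctSum (s : Finset ι) (n : ι → ℕ) (w : ℕ → ℝ≥0∞) : ℝ≥0∞ :=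
  ∑' j : s → ℕ, if Function.Injective j then ∏ i, w (j i) ^ n i else 0

/-- The sequence with first entry `v`, followed by the sequence `w`. -/
def consSeq {α : Type*} (v : α) (w : ℕ → α) : ℕ → α
  | 0 => v
  | c + 1 => w c

theorem distinctSum_empty (n : ι → ℕ) (w : ℕ → ℝ≥0∞) : distinctSum ∅ n w = 1 := by
  unfold distinctSum
  rw [tsum_eq_single (fun i : (∅ : Finset ι) => (0 : ℕ))
    (fun j hj => absurd (Subsingleton.elim _ _) hj)]
  simp [Function.injective_of_subsingleton]

theorem measurable_distinctSum (s : Finset ι) (n : ι → ℕ) : Measurable (distinctSum s n) := by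
  refine Measurable.tsum fun j => ?_
  split_ifs
  · exact Finset.measurable_fun_prod _ fun i _ => (measurable_pi_apply _).pow_const _
  · exact measurable_const

theorem distinctSum_const_mul (s : Finset ι) (n : ι → ℕ) (a : ℝ≥0∞) (w : ℕ → ℝ≥0∞) :
    distinctSum s n (fun c => a * w c) = a ^ (∑ i ∈ s, n i) * distinctSum s n w := by
  classical
  unfold distinctSum
  rw [← ENNReal.tsum_mul_left]
  refine tsum_congr fun j => ?_
  simp only [mul_pow, Finset.prod_mul_distrib, mul_ite, mul_zero, Finset.prod_pow_eq_pow_sum]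
  rw [Finset.sum_coe_sort s n]

/-- Composition with `e` permutes the injective families. This is what makes the decreasing
rearrangement irrelevant to the moments. -/
theorem distinctSum_comp_equiv (s : Finset ι) (n : ι → ℕ) (e : ℕ ≃ ℕ) (w : ℕ → ℝ≥0∞) :
    distinctSum s n (fun c => w (e c)) = distinctSum s n w := by
  classical
  unfold distinctSum
  rw [← (Equiv.arrowCongr (Equiv.refl {i // i ∈ s}) e).tsum_eq
    (fun j : s → ℕ => if Function.Injective j then ∏ i, w (j i) ^ n i else 0)]
  refine tsum_congr fun j => ?_
  have : Function.Injective (Equiv.arrowCongr (Equiv.refl {i // i ∈ s}) e j)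
      ↔ Function.Injective j := by
    simp [Equiv.arrowCongr]
  simp only [this]
  simp

variable [DecidableEq ι]

/-- Choose the index c of `a` first; the others must avoid c. Since their exponents are nonzero,
replacing `w c` by 0 kills exactly the families that do not. -/
theorem distinctSum_insert {s : Finset ι} {a : ι} (ha : a ∉ s) {n : ι → ℕ}
    (hn : ∀ i ∈ s, n i ≠ 0) (w : ℕ → ℝ≥0∞) :
    distinctSum (insert a s) n w
      = ∑' c, w c ^ n a * distinctSum s n (Function.update w c 0) := by
  classical
  let e₀ : {i // i ∈ insert a s} ≃ Option {i // i ∈ s} := Finset.subtypeInsertEquivOption ha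
  have e₀s : ∀ i : {i // i ∈ s}, (e₀.symm (some i) : ι) = i := fun i => rfl
  have e₀n : (e₀.symm none : ι) = a := rfl
  let e : (ℕ × ({i // i ∈ s} → ℕ)) ≃ ({i // i ∈ insert a s} → ℕ) :=
    (Equiv.piOptionEquivProd (β := fun _ => ℕ)).symm.trans
      (Equiv.arrowCongr e₀.symm (Equiv.refl ℕ))
  have en : ∀ p, e p (e₀.symm none) = p.1 := fun p => by simp [e]
  have es : ∀ p i, e p (e₀.symm (some i)) = p.2 i := fun p i => by simp [e]
  unfold distinctSum
  rw [← e.tsum_eq, ENNReal.tsum_prod']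
  refine tsum_congr fun c => ?_
  rw [← ENNReal.tsum_mul_left]
  refine tsum_congr fun j => ?_
  have hprod : ∏ i, w (e (c, j) i) ^ n i = w c ^ n a * ∏ i, w (j i) ^ n i := by
    rw [← e₀.symm.prod_comp, Fintype.prod_option, en, e₀n]
    congr 1
    exact Finset.prod_congr rfl fun i _ => by rw [es, e₀s]
  have hinj : Function.Injective (e (c, j)) ↔ Function.Injective j ∧ ∀ i, j i ≠ c := by
    constructor
    · intro h
      refine ⟨fun i i' hii => ?_, fun i hi => ?_⟩
      · have := @h (e₀.symm (some i)) (e₀.symm (some i')) (by rw [es, es]; exact hii)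
        simpa using this
      · have := @h (e₀.symm (some i)) (e₀.symm none) (by rw [es, en]; exact hi)
        simp at this
    · rintro ⟨h1, h2⟩ i i' hii
      obtain ⟨o, rfl⟩ := e₀.symm.surjective i
      obtain ⟨o', rfl⟩ := e₀.symm.surjective i'
      rcases o with _ | o <;> rcases o' with _ | o' <;> simp only [es, en] at hii
      · rfl
      · exact absurd hii.symm (h2 o')
      · exact absurd hii (h2 o)
      · rw [h1 hii]
  rw [hprod]
  by_cases h1 : Function.Injective j
  · by_cases h2 : ∀ i, j i ≠ c
    · rw [if_pos (hinj.2 ⟨h1, h2⟩), if_pos h1]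
      congr 1
      exact Finset.prod_congr rfl fun i _ => by rw [Function.update_of_ne (h2 i)]
    · rw [if_neg (fun h => h2 (hinj.1 h).2), if_pos h1]
      push Not at h2
      obtain ⟨i, hi⟩ := h2
      rw [Finset.prod_eq_zero (Finset.mem_univ i), mul_zero]
      rw [hi, Function.update_self, zero_pow (hn i i.2)]
  · rw [if_neg (fun h => h1 (hinj.1 h).1), if_neg h1, mul_zero]

theorem update_consSeq_zero (v u : ℝ≥0∞) (w : ℕ → ℝ≥0∞) :
    Function.update (consSeq v w) 0 u = consSeq u w := by
  ext c; cases c <;> simp [consSeq]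

theorem update_consSeq_succ (v u : ℝ≥0∞) (w : ℕ → ℝ≥0∞) (c : ℕ) :
    Function.update (consSeq v w) (c + 1) u = consSeq v (Function.update w c u) := by
  ext d
  cases d with
  | zero => simp [consSeq]
  | succ d => simp [consSeq, Function.update_apply]

/-- By distinctness, the first entry `v` is used by no element of `s` or by exactly one. -/
theorem distinctSum_consSeq (s : Finset ι) {n : ι → ℕ} (hn : ∀ i ∈ s, n i ≠ 0) (v : ℝ≥0∞)
    (w : ℕ → ℝ≥0∞) :
    distinctSum s n (consSeq v w)
      = distinctSum s n w + ∑ i ∈ s, v ^ n i * distinctSum (s.erase i) n w := by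
  induction s using Finset.induction_on generalizing v w with
  | empty => simp [distinctSum_empty]
  | insert a s ha ih =>
    have hn' : ∀ i ∈ s, n i ≠ 0 := fun i hi => hn i (Finset.mem_insert_of_mem hi)
    -- When `a` takes the first entry, that entry becomes 0 for the others and can be deleted.
    have h0 : ∀ w, distinctSum s n (consSeq 0 w) = distinctSum s n w := fun w => by
      rw [ih hn', Finset.sum_eq_zero, add_zero]
      intro i hi
      rw [zero_pow (hn' i hi), zero_mul]
    rw [distinctSum_insert ha hn', tsum_eq_zero_add' ENNReal.summable, update_consSeq_zero, h0,
      Finset.sum_insert ha, Finset.erase_insert ha, distinctSum_insert ha hn', ← add_assoc,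
      add_comm (∑' c, _ : ℝ≥0∞), add_assoc]
    congr 1
    simp only [update_consSeq_succ, ih hn', mul_add, ENNReal.tsum_add]
    congr 1
    simp only [Finset.mul_sum]
    rw [Summable.tsum_finsetSum fun _ _ => ENNReal.summable]
    refine Finset.sum_congr rfl fun i hi => ?_
    rw [Finset.erase_insert_of_ne (ne_of_mem_of_not_mem hi ha).symm,
      distinctSum_insert (fun h => ha (Finset.mem_of_mem_erase h))
        (fun i' hi' => hn' i' (Finset.mem_of_mem_erase hi')), ← ENNReal.tsum_mul_left]
    refine tsum_congr fun c => ?_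
    simp only [consSeq]
    ring

/-- Provides the finiteness needed to solve the recursion for the moments, where the unknown occurs
on both sides. -/
theorem distinctSum_le_one (s : Finset ι) {n : ι → ℕ} (hn : ∀ i ∈ s, n i ≠ 0) {w : ℕ → ℝ≥0∞}
    (hw : ∑' c, w c ≤ 1) : distinctSum s n w ≤ 1 := by
  induction s using Finset.induction_on generalizing w with
  | empty => rw [distinctSum_empty]
  | insert a s ha ih =>
    have hn' : ∀ i ∈ s, n i ≠ 0 := fun i hi => hn i (Finset.mem_insert_of_mem hi)
    rw [distinctSum_insert ha hn']
    refine le_trans (ENNReal.tsum_le_tsum fun c => ?_) hw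
    have h1 : distinctSum s n (Function.update w c 0) ≤ 1 := by
      refine ih hn' (le_trans (ENNReal.tsum_le_tsum fun d => ?_) hw)
      rw [Function.update_apply]
      split_ifs <;> simp
    calc _ ≤ w c ^ n a * 1 := by gcongr
      _ ≤ w c := by
        rw [mul_one]
        exact pow_le_of_le_one zero_le ((ENNReal.le_tsum c).trans hw)
          (hn a (Finset.mem_insert_self _ _))

end DistinctSum


/-! ### Moments of the GEM distribution -/

/-- The rising factorial `t (t + 1) ⋯ (t + N - 1)`. -/
def risingFactorial (t : ℝ) (N : ℕ) : ℝ := ∏ j ∈ Finset.range N, (t + j)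

theorem risingFactorial_succ (t : ℝ) (N : ℕ) :
    risingFactorial t (N + 1) = risingFactorial t N * (t + N) :=
  Finset.prod_range_succ _ _

theorem risingFactorial_pos {t : ℝ} (ht : 0 < t) (N : ℕ) : 0 < risingFactorial t N :=
  Finset.prod_pos fun _ _ => by positivity

theorem Gamma_add_nat_eq {t : ℝ} (ht : 0 < t) (N : ℕ) :
    Real.Gamma (t + N) = risingFactorial t N * Real.Gamma t := by
  induction N with
  | zero => simp [risingFactorial]
  | succ N ih =>
    rw [Nat.cast_succ, ← add_assoc, Real.Gamma_add_one (by positivity), ih, risingFactorial_succ]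
    ring

/-- The integrand times the density is a multiple of the Beta(a+1, t+b) density, so the integral is
B(a+1, t+b) / B(1, t). -/
theorem lintegral_pow_mul_pow_beta {t : ℝ} (ht : 0 < t) (a b : ℕ) :
    ∫⁻ v, ENNReal.ofReal v ^ a * ENNReal.ofReal (1 - v) ^ b ∂(betaMeasure 1 t)
      = ENNReal.ofReal
        (t * a.factorial * risingFactorial t b / risingFactorial t (a + b + 1)) := by
  have ha : (0 : ℝ) < a + 1 := by positivity
  have hb : 0 < t + b := by positivity
  have hB := beta_pos ha hb
  have hB1 := beta_pos one_pos ht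
  have h0 : ∀ v, betaPDF 1 t v * (ENNReal.ofReal v ^ a * ENNReal.ofReal (1 - v) ^ b)
      = ENNReal.ofReal (beta (a + 1) (t + b) / beta 1 t) * betaPDF (a + 1) (t + b) v := by
    intro v
    simp only [betaPDF_eq]
    split_ifs with hv
    · have hv0 := hv.1
      have hv1 : 0 < 1 - v := by linarith [hv.2]
      rw [← ENNReal.ofReal_pow hv0.le, ← ENNReal.ofReal_pow hv1.le,
        ← ENNReal.ofReal_mul (by positivity), ← ENNReal.ofReal_mul (by positivity),
        ← ENNReal.ofReal_mul (by positivity)]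
      congr 1
      have e1 : v ^ ((a : ℝ) + 1 - 1) = v ^ a := by rw [add_sub_cancel_right, Real.rpow_natCast]
      have e2 : (1 - v) ^ (t + b - 1) = (1 - v) ^ (t - 1) * (1 - v) ^ b := by
        rw [← Real.rpow_natCast, ← Real.rpow_add hv1]
        congr 1
        ring
      rw [e1, e2, sub_self, Real.rpow_zero]
      field_simp
    · simp
  rw [betaMeasure, lintegral_withDensity_eq_lintegral_mul _ (by unfold betaPDF; fun_prop)
    (by fun_prop)]
  simp only [Pi.mul_apply, h0]
  rw [lintegral_const_mul _ (by unfold betaPDF; fun_prop), lintegral_betaPDF_eq_one ha hb, mul_one]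
  congr 1
  have hg := Real.Gamma_pos_of_pos ht
  have hr := risingFactorial_pos ht
  have e : (a : ℝ) + 1 + (t + b) = t + ((a + b + 1 : ℕ) : ℝ) := by push_cast; ring
  unfold beta
  rw [e, Gamma_add_nat_eq ht, Gamma_add_nat_eq ht, Real.Gamma_nat_eq_factorial, Real.Gamma_one,
    add_comm 1 t, Real.Gamma_add_one ht.ne']
  have h1 := hr (a + b + 1)
  field_simp

theorem ae_mem_Ioo_betaMeasure (t : ℝ) : ∀ᵐ v ∂(betaMeasure 1 t), v ∈ Set.Ioo (0 : ℝ) 1 := by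
  rw [betaMeasure, ae_withDensity_iff (by unfold betaPDF; fun_prop)]
  refine Filter.Eventually.of_forall fun v hv => ?_
  by_contra h
  exact hv (by rw [betaPDF_eq, if_neg (by exact h), ENNReal.ofReal_zero])

theorem measurePreserving_consSeq {T : Type*} [MeasurableSpace T] (μ : Measure T)
    [IsProbabilityMeasure μ] :
    MeasurePreserving (fun p : T × (ℕ → T) => consSeq p.1 p.2)
      (μ.prod (Measure.infinitePi fun _ : ℕ => μ)) (Measure.infinitePi fun _ : ℕ => μ) := by
  have hm : Measurable (fun p : T × (ℕ → T) => consSeq p.1 p.2) := by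
    refine measurable_pi_lambda _ fun c => ?_
    cases c with
    | zero => exact measurable_fst
    | succ c => exact (measurable_pi_apply c).comp measurable_snd
  refine ⟨hm, Measure.eq_infinitePi _ fun s t ht => ?_⟩
  have hs : MeasurableSet (Set.pi (s : Set ℕ) t) :=
    MeasurableSet.pi s.countable_toSet fun i _ => ht i
  let s' : Finset ℕ := s.preimage Nat.succ Nat.succ_injective.injOn
  -- The constraint on the head of the sequence, void if the cylinder does not involve coordinate 0.
  let t₀ : Set T := if 0 ∈ s then t 0 else Set.univ
  have hpre : (fun p : T × (ℕ → T) => consSeq p.1 p.2) ⁻¹' (Set.pi (s : Set ℕ) t)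
      = t₀ ×ˢ Set.pi (s' : Set ℕ) (fun c => t (c + 1)) := by
    ext ⟨v, w⟩
    simp only [Set.mem_preimage, Set.mem_pi, Finset.mem_coe, Set.mem_prod, s', t₀,
      Finset.mem_preimage]
    constructor
    · intro h
      refine ⟨?_, fun c hc => h (c + 1) hc⟩
      split_ifs with h0
      · exact h 0 h0
      · trivial
    · rintro ⟨h0, h⟩ c hc
      cases c with
      | zero => rwa [if_pos hc] at h0
      | succ c => exact h c hc
  rw [Measure.map_apply hm hs, hpre, Measure.prod_prod, Measure.infinitePi_pi _ fun i _ => ht _]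
  have hsum : ∏ i ∈ s' , μ (t (i + 1)) = ∏ i ∈ s with i ≠ 0, μ (t i) := by
    refine Finset.prod_bij (fun i _ => i + 1) ?_ ?_ ?_ ?_
    · intro i hi
      simpa [s'] using hi
    · intro i _ j _ h
      simpa using h
    · intro i hi
      rw [Finset.mem_filter] at hi
      obtain ⟨k, rfl⟩ := Nat.exists_eq_succ_of_ne_zero hi.2
      exact ⟨k, by simpa [s'] using hi.1, rfl⟩
    · intro i _
      rfl
  rw [hsum]
  by_cases h0 : 0 ∈ s
  · simp only [t₀, if_pos h0, Finset.filter_ne']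
    exact Finset.mul_prod_erase s (fun i => μ (t i)) h0
  · simp only [t₀, if_neg h0, measure_univ, one_mul, Finset.filter_ne']
    rw [Finset.erase_eq_of_notMem h0]

/-- The self-similarity of stick breaking, the source of the moment recursion. -/
theorem stickBreaking_consSeq (v : ℝ) (u : ℕ → ℝ) :
    stickBreaking (consSeq v u) = consSeq v (fun c => (1 - v) * stickBreaking u c) := by
  ext c
  cases c with
  | zero => simp [stickBreaking, consSeq]
  | succ c =>
    simp only [stickBreaking, Finset.prod_range_succ', consSeq]
    ring

theorem sum_stickBreaking (v : ℕ → ℝ) (N : ℕ) :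
    ∑ c ∈ Finset.range N, stickBreaking v c = 1 - ∏ j ∈ Finset.range N, (1 - v j) := by
  induction N with
  | zero => simp
  | succ N ih =>
    rw [Finset.sum_range_succ, ih, Finset.prod_range_succ, stickBreaking]
    ring

theorem stickBreaking_pos {v : ℕ → ℝ} (hv : ∀ i, v i ∈ Set.Ioo (0 : ℝ) 1) (c : ℕ) :
    0 < stickBreaking v c :=
  mul_pos (hv c).1 (Finset.prod_pos fun i _ => by linarith [(hv i).2])

theorem sum_stickBreaking_le_one {v : ℕ → ℝ} (hv : ∀ i, v i ∈ Set.Ioo (0 : ℝ) 1) (N : ℕ) :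
    ∑ c ∈ Finset.range N, stickBreaking v c ≤ 1 := by
  rw [sum_stickBreaking]
  have : 0 ≤ ∏ j ∈ Finset.range N, (1 - v j) :=
    Finset.prod_nonneg fun i _ => by linarith [(hv i).2]
  linarith

theorem tsum_ofReal_stickBreaking_le_one {v : ℕ → ℝ} (hv : ∀ i, v i ∈ Set.Ioo (0 : ℝ) 1) :
    ∑' c, ENNReal.ofReal (stickBreaking v c) ≤ 1 := by
  rw [ENNReal.tsum_eq_iSup_nat]
  refine iSup_le fun N => ?_
  rw [← ENNReal.ofReal_sum_of_nonneg fun c _ => (stickBreaking_pos hv c).le,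
    ← ENNReal.ofReal_one]
  exact ENNReal.ofReal_le_ofReal (sum_stickBreaking_le_one hv N)

theorem ae_forall_mem_Ioo_infinitePi {t : ℝ} (ht : 0 < t) :
    ∀ᵐ v ∂(Measure.infinitePi fun _ : ℕ => betaMeasure 1 t), ∀ i, v i ∈ Set.Ioo (0 : ℝ) 1 := by
  have := isProbabilityMeasureBeta one_pos ht
  rw [ae_all_iff]
  intro i
  exact (measurePreserving_eval_infinitePi (fun _ : ℕ => betaMeasure 1 t) i).quasiMeasurePreserving.ae
    (ae_mem_Ioo_betaMeasure t)

section GemMoment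

variable {ι : Type*}

/-- The expectation of `distinctSum` for stick breaking with parameter `t`. -/
def gemMoment (t : ℝ) (s : Finset ι) (n : ι → ℕ) : ℝ≥0∞ :=
  ∫⁻ v, distinctSum s n (fun c => ENNReal.ofReal (stickBreaking v c))
    ∂(Measure.infinitePi fun _ : ℕ => betaMeasure 1 t)

theorem measurable_distinctSum_stickBreaking (s : Finset ι) (n : ι → ℕ) :
    Measurable fun v => distinctSum s n (fun c => ENNReal.ofReal (stickBreaking v c)) :=
  (measurable_distinctSum s n).comp (measurable_pi_lambda _ fun c =>
    ((measurable_pi_apply c).comp measurable_stickBreaking).ennreal_ofReal)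

variable [DecidableEq ι]

theorem gemMoment_le_one {t : ℝ} (ht : 0 < t) (s : Finset ι) {n : ι → ℕ}
    (hn : ∀ i ∈ s, n i ≠ 0) : gemMoment t s n ≤ 1 := by
  have := isProbabilityMeasureBeta one_pos ht
  calc gemMoment t s n ≤ ∫⁻ _, 1 ∂(Measure.infinitePi fun _ : ℕ => betaMeasure 1 t) := by
        refine lintegral_mono_ae ?_
        filter_upwards [ae_forall_mem_Ioo_infinitePi ht] with v hv
        exact distinctSum_le_one s hn (tsum_ofReal_stickBreaking_le_one hv)
    _ = 1 := by simp

/-- Expand `distinctSum` along the first stick V; the remaining sticks carry the factor 1-V, which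
comes out as a power by homogeneity, and independence splits the integrals. -/
theorem gemMoment_recursion {t : ℝ} (ht : 0 < t) (s : Finset ι) {n : ι → ℕ}
    (hn : ∀ i ∈ s, n i ≠ 0) :
    gemMoment t s n
      = (∫⁻ v, ENNReal.ofReal v ^ 0 * ENNReal.ofReal (1 - v) ^ (∑ i ∈ s, n i) ∂(betaMeasure 1 t))
          * gemMoment t s n
        + ∑ i ∈ s, (∫⁻ v, ENNReal.ofReal v ^ n i
            * ENNReal.ofReal (1 - v) ^ (∑ i ∈ s.erase i, n i) ∂(betaMeasure 1 t))
          * gemMoment t (s.erase i) n := by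
  have := isProbabilityMeasureBeta one_pos ht
  set ν := Measure.infinitePi fun _ : ℕ => betaMeasure 1 t
  have hS := fun s : Finset ι => measurable_distinctSum_stickBreaking s n
  have hprod : ∀ (a b : ℕ) (s : Finset ι),
      (∫⁻ v, ENNReal.ofReal v ^ a * ENNReal.ofReal (1 - v) ^ b ∂(betaMeasure 1 t))
          * gemMoment t s n
        = ∫⁻ p, (ENNReal.ofReal p.1 ^ a * ENNReal.ofReal (1 - p.1) ^ b)
            * distinctSum s n (fun c => ENNReal.ofReal (stickBreaking p.2 c))
          ∂((betaMeasure 1 t).prod ν) := by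
    intro a b s
    exact (lintegral_prod_mul (f := fun v => ENNReal.ofReal v ^ a * ENNReal.ofReal (1 - v) ^ b)
      (by fun_prop) (hS s).aemeasurable).symm
  have hmeas : ∀ (a b : ℕ) (s : Finset ι), Measurable fun p : ℝ × (ℕ → ℝ) =>
      (ENNReal.ofReal p.1 ^ a * ENNReal.ofReal (1 - p.1) ^ b)
        * distinctSum s n (fun c => ENNReal.ofReal (stickBreaking p.2 c)) := fun a b s =>
    Measurable.mul (by fun_prop) ((hS s).comp measurable_snd)
  simp only [hprod]
  rw [← lintegral_finsetSum _ fun i _ => hmeas _ _ _, ← lintegral_add_left (hmeas _ _ _),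
    gemMoment, ← (measurePreserving_consSeq (betaMeasure 1 t)).lintegral_comp (hS s)]
  refine lintegral_congr_ae ?_
  have hae : ∀ᵐ p ∂((betaMeasure 1 t).prod ν), p.1 ∈ Set.Ioo (0 : ℝ) 1 :=
    Measure.quasiMeasurePreserving_fst.ae (ae_mem_Ioo_betaMeasure t)
  filter_upwards [hae] with p hp
  have hp1 : 0 ≤ 1 - p.1 := by linarith [hp.2]
  have e : (fun c => ENNReal.ofReal (stickBreaking (consSeq p.1 p.2) c))
      = consSeq (ENNReal.ofReal p.1)
        (fun c => ENNReal.ofReal (1 - p.1) * ENNReal.ofReal (stickBreaking p.2 c)) := by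
    ext c
    rw [stickBreaking_consSeq]
    cases c with
    | zero => rfl
    | succ c => exact ENNReal.ofReal_mul hp1
  rw [e, distinctSum_consSeq s hn]
  simp only [distinctSum_const_mul, pow_zero, one_mul, mul_assoc]

/-- With M the sum of the exponents, the moment reappears on the right of the recursion with
coefficient t / (t + M) < 1, and the other terms involve one element fewer. Hence induction on the
cardinality determines it. -/
theorem gemMoment_eq {t : ℝ} (ht : 0 < t) (s : Finset ι) {n : ι → ℕ} (hn : ∀ i ∈ s, n i ≠ 0) :
    gemMoment t s n = ENNReal.ofReal
      (t ^ s.card * (∏ i ∈ s, ((n i - 1).factorial : ℝ)) / risingFactorial t (∑ i ∈ s, n i)) := by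
  have hprob := isProbabilityMeasureBeta one_pos ht
  induction hk : s.card generalizing s with
  | zero =>
    obtain rfl := Finset.card_eq_zero.mp hk
    simp [gemMoment, distinctSum_empty, risingFactorial]
  | succ k ih =>
    set M := ∑ i ∈ s, n i with hM
    set c : ℝ := ∏ i ∈ s, ((n i - 1).factorial : ℝ) with hc
    have hr := risingFactorial_pos ht
    have hrec := gemMoment_recursion ht s hn
    -- The term of i is `n i` times a quantity independent of i, so these terms add up to M times
    -- that quantity.
    have hterm : ∀ i ∈ s, (∫⁻ v, ENNReal.ofReal v ^ n i
            * ENNReal.ofReal (1 - v) ^ (∑ i ∈ s.erase i, n i) ∂(betaMeasure 1 t))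
          * gemMoment t (s.erase i) n
        = ENNReal.ofReal (n i * (t ^ (k + 1) * c / risingFactorial t (M + 1))) := by
      intro i hi
      have hsum : n i + ∑ i ∈ s.erase i, n i = M := Finset.add_sum_erase s n hi
      have hcprod : ((n i - 1).factorial : ℝ) * ∏ i ∈ s.erase i, ((n i - 1).factorial : ℝ) = c :=
        Finset.mul_prod_erase s (fun i => ((n i - 1).factorial : ℝ)) hi
      rw [ih (s.erase i) (fun i' hi' => hn i' (Finset.mem_of_mem_erase hi'))
        (by rw [Finset.card_erase_of_mem hi, hk]; rfl), lintegral_pow_mul_pow_beta ht,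
        ← ENNReal.ofReal_mul (by
          have := hr (∑ i ∈ s.erase i, n i)
          have := hr (n i + ∑ i ∈ s.erase i, n i + 1)
          positivity), hsum]
      congr 1
      have h1 := hr (∑ i ∈ s.erase i, n i)
      have h2 := hr (M + 1)
      have hf : ((n i).factorial : ℝ) = n i * (n i - 1).factorial := by
        rw [← Nat.mul_factorial_pred (hn i hi)]
        push_cast
        rfl
      rw [← hcprod, hf]
      field_simp
      ring
    rw [Finset.sum_congr rfl hterm, lintegral_pow_mul_pow_beta ht] at hrec
    obtain ⟨i₀, hi₀⟩ : s.Nonempty := Finset.card_pos.mp (by omega)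
    have hMpos : (0 : ℝ) < M := by
      have h1 : n i₀ ≤ M := Finset.single_le_sum (fun _ _ => Nat.zero_le _) hi₀
      have := hn i₀ hi₀
      exact_mod_cast (by omega : 0 < M)
    have hfin : gemMoment t s n ≠ ∞ := ((gemMoment_le_one ht s hn).trans_lt ENNReal.one_lt_top).ne
    have hcpos : 0 < c := Finset.prod_pos fun i _ => by positivity
    have hM1 := hr (M + 1)
    have hM0 := hr M
    rw [← ENNReal.ofReal_sum_of_nonneg fun i _ => by positivity, ← Finset.sum_mul,
      ← Nat.cast_sum, ← hM, ← ENNReal.ofReal_toReal hfin] at hrec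
    have hx : 0 ≤ (gemMoment t s n).toReal := ENNReal.toReal_nonneg
    rw [← ENNReal.ofReal_toReal hfin]
    set I := (gemMoment t s n).toReal
    rw [zero_add] at hrec
    rw [← ENNReal.ofReal_mul (by positivity), ← ENNReal.ofReal_add (by positivity) (by positivity),
      ENNReal.ofReal_eq_ofReal_iff hx (by positivity)] at hrec
    congr 1
    rw [risingFactorial_succ] at hrec
    have htM : 0 < t + M := by positivity
    field_simp at hrec ⊢
    simp only [Nat.factorial_zero, Nat.cast_one, mul_one] at hrec
    have : (M : ℝ) * (I * risingFactorial t M) = M * (t ^ (k + 1) * c) := by linear_combination hrec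
    exact mul_left_cancel₀ hMpos.ne' this

end GemMoment

/-! ### Moments of the Poisson–Dirichlet distribution -/

/-! ### Decreasing rearrangement of a positive null sequence as a permutation of its indices. -/

section DecreasingRearrangement

/-- The indices that precede `i` in the decreasing rearrangement of `w`, ties being broken by the
order of the indices. -/
def precedingIndices (w : ℕ → ℝ) (i : ℕ) : Set ℕ := {c | w i < w c ∨ (w c = w i ∧ c < i)}

/-- The position of the index `i` in the decreasing rearrangement of `w`. -/
def decreasingRank (w : ℕ → ℝ) (i : ℕ) : ℕ := (precedingIndices w i).ncard

variable {w : ℕ → ℝ}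

theorem finite_precedingIndices (hpos : ∀ i, 0 < w i)
    (hlim : Filter.Tendsto w Filter.atTop (nhds 0)) (i : ℕ) : (precedingIndices w i).Finite := by
  obtain ⟨N, hN⟩ := Filter.eventually_atTop.mp (hlim.eventually_lt_const (hpos i))
  refine (Set.finite_Iio N).subset fun c hc => ?_
  by_contra h
  have := hN c (not_lt.mp h)
  rcases hc with hc | hc
  · exact lt_asymm this hc
  · exact this.ne hc.1

theorem decreasingRank_lt (hpos : ∀ i, 0 < w i)
    (hlim : Filter.Tendsto w Filter.atTop (nhds 0)) {c i : ℕ} (h : c ∈ precedingIndices w i) :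
    decreasingRank w c < decreasingRank w i := by
  refine Set.ncard_lt_ncard ?_ (finite_precedingIndices hpos hlim i)
  rw [Set.ssubset_iff_of_subset]
  · exact ⟨c, h, by simp [precedingIndices]⟩
  · intro d hd
    rcases h with h | h <;> rcases hd with hd | hd
    · exact Or.inl (h.trans hd)
    · exact Or.inl (hd.1 ▸ h)
    · exact Or.inl (h.1 ▸ hd)
    · exact Or.inr ⟨hd.1.trans h.1, hd.2.trans h.2⟩

/-- Precedence is a total order, so ranks are injective and hence unbounded. The predecessors of an
index of rank r have r distinct ranks below r, thus all of them, and no rank is skipped. -/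
theorem bijective_decreasingRank (hpos : ∀ i, 0 < w i)
    (hlim : Filter.Tendsto w Filter.atTop (nhds 0)) : Function.Bijective (decreasingRank w) := by
  have hinj : Function.Injective (decreasingRank w) := by
    intro i i' h
    by_contra hne
    have key : i ∈ precedingIndices w i' ∨ i' ∈ precedingIndices w i := by
      rcases lt_trichotomy (w i) (w i') with h1 | h1 | h1
      · exact Or.inr (Or.inl h1)
      · rcases lt_or_gt_of_ne hne with h2 | h2
        · exact Or.inl (Or.inr ⟨h1, h2⟩)
        · exact Or.inr (Or.inr ⟨h1.symm, h2⟩)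
      · exact Or.inl (Or.inl h1)
    rcases key with key | key
    · exact (decreasingRank_lt hpos hlim key).ne h
    · exact (decreasingRank_lt hpos hlim key).ne h.symm
  refine ⟨hinj, fun k => ?_⟩
  obtain ⟨_, ⟨i, rfl⟩, hi⟩ := (Set.infinite_range_of_injective hinj).exists_gt k
  have heq : decreasingRank w '' precedingIndices w i = Set.Iio (decreasingRank w i) := by
    refine Set.eq_of_subset_of_ncard_le ?_ ?_ (Set.finite_Iio _)
    · rintro _ ⟨c, hc, rfl⟩
      exact decreasingRank_lt hpos hlim hc
    · rw [Set.ncard_image_of_injective _ hinj, ← Finset.coe_Iio, Set.ncard_coe_finset,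
        Nat.card_Iio]
      rfl
  have hk : k ∈ decreasingRank w '' precedingIndices w i := by
    rw [heq]
    exact hi
  obtain ⟨c, _, hc⟩ := hk
  exact ⟨c, hc⟩

/-- The supremum is attained at i together with its predecessors. Any other set of this size
contains an index that does not precede i, whose value is at most `w i`. -/
theorem decreasingRearrangement_decreasingRank (hpos : ∀ i, 0 < w i)
    (hlim : Filter.Tendsto w Filter.atTop (nhds 0)) (i : ℕ) :
    decreasingRearrangement w (decreasingRank w i) = w i := by
  have hfin := finite_precedingIndices hpos hlim i
  let s₀ : Finset ℕ := insert i hfin.toFinset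
  have hs₀ : s₀.card = decreasingRank w i + 1 := by
    rw [Finset.card_insert_of_notMem (by simp [precedingIndices]), decreasingRank,
      Set.ncard_eq_toFinset_card _ hfin]
  have hle : ∀ s : {s : Finset ℕ // s.card = decreasingRank w i + 1},
      s.1.inf' (Finset.card_pos.mp (by rw [s.2]; exact Nat.succ_pos _)) w ≤ w i := by
    rintro ⟨s, hs⟩
    obtain ⟨c, hcs, hc⟩ : ∃ c ∈ s, c ∉ hfin.toFinset := by
      by_contra! h
      have h1 := Finset.card_le_card (show s ⊆ hfin.toFinset from h)
      rw [hs, ← Set.ncard_eq_toFinset_card _ hfin] at h1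
      exact absurd h1 (Nat.not_succ_le_self _)
    refine (Finset.inf'_le w hcs).trans ?_
    by_contra! h
    exact hc (hfin.mem_toFinset.mpr (Or.inl h))
  have : Nonempty {s : Finset ℕ // s.card = decreasingRank w i + 1} := ⟨⟨s₀, hs₀⟩⟩
  refine le_antisymm (ciSup_le hle) ?_
  refine le_ciSup_of_le ⟨w i, ?_⟩ ⟨s₀, hs₀⟩ ?_
  · rintro _ ⟨s, rfl⟩
    exact hle s
  · refine Finset.le_inf' _ _ fun c hc => ?_
    rcases Finset.mem_insert.mp hc with rfl | hc
    · exact le_rfl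
    · rcases hfin.mem_toFinset.mp hc with hc | hc
      · exact hc.le
      · exact hc.1.ge

end DecreasingRearrangement

theorem risingFactorial_succ' (t : ℝ) (N : ℕ) :
    risingFactorial t (N + 1) = t * risingFactorial (t + 1) N := by
  unfold risingFactorial
  rw [Finset.prod_range_succ', Nat.cast_zero, add_zero, mul_comm]
  congr 1
  refine Finset.prod_congr rfl fun j _ => ?_
  push_cast
  ring

theorem risingFactorial_one (N : ℕ) : risingFactorial 1 N = N.factorial := by
  induction N with
  | zero => simp [risingFactorial]
  | succ N ih =>
    rw [risingFactorial_succ, ih, Nat.factorial_succ]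
    push_cast
    ring

section PoissonDirichletMoment

variable {ι : Type*}

theorem measurable_distinctSum_ofReal (s : Finset ι) (n : ι → ℕ) :
    Measurable fun l : ℕ → ℝ => distinctSum s n (fun c => ENNReal.ofReal (l c)) :=
  (measurable_distinctSum s n).comp (measurable_pi_lambda _ fun c =>
    (measurable_pi_apply c).ennreal_ofReal)

variable [DecidableEq ι]

theorem distinctSum_zero (s : Finset ι) {n : ι → ℕ} (hn : ∀ i ∈ s, n i ≠ 0) :
    distinctSum s n (fun _ => 0) = if s = ∅ then 1 else 0 := by
  induction s using Finset.induction_on with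
  | empty => simp [distinctSum_empty]
  | insert a s ha _ =>
    rw [distinctSum_insert ha fun i hi => hn i (Finset.mem_insert_of_mem hi)]
    simp [zero_pow (hn a (Finset.mem_insert_self _ _))]

theorem distinctSum_single (s : Finset ι) {n : ι → ℕ} (hn : ∀ i ∈ s, n i ≠ 0)
    (hs : s.Nonempty) :
    distinctSum s n (fun c => ENNReal.ofReal ((Pi.single 0 1 : ℕ → ℝ) c))
      = if s.card = 1 then 1 else 0 := by
  have e : (fun c => ENNReal.ofReal ((Pi.single 0 1 : ℕ → ℝ) c)) = consSeq 1 (fun _ => 0) := by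
    ext c
    cases c <;> simp [consSeq]
  rw [e, distinctSum_consSeq s hn, distinctSum_zero s hn, if_neg hs.ne_empty, zero_add]
  have h : ∀ i ∈ s, (1 : ℝ≥0∞) ^ n i * distinctSum (s.erase i) n (fun _ => 0)
      = if s.card = 1 then 1 else 0 := by
    intro i hi
    rw [one_pow, one_mul, distinctSum_zero _ fun i' hi' => hn i' (Finset.mem_of_mem_erase hi')]
    have h1 := Finset.card_erase_of_mem hi
    have h2 := Finset.card_pos.mpr hs
    have : s.erase i = ∅ ↔ s.card = 1 := by
      rw [← Finset.card_eq_zero]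
      omega
    simp only [this]
  rw [Finset.sum_congr rfl h]
  split_ifs with h1 <;> simp [h1]

/-- A factor θ has been cancelled from the stick-breaking formula, so that the same expression
covers θ = 0: there the single circle admits only one cycle, in accordance with 0 ^ 0 = 1. -/
theorem lintegral_distinctSum_poissonDirichlet (θ : ℝ≥0) {s : Finset ι} (hs : s.Nonempty)
    {n : ι → ℕ} (hn : ∀ i ∈ s, n i ≠ 0) :
    ∫⁻ l, distinctSum s n (fun c => ENNReal.ofReal (l c)) ∂(poissonDirichlet θ)
      = ENNReal.ofReal ((θ : ℝ) ^ (s.card - 1) * (∏ i ∈ s, ((n i - 1).factorial : ℝ))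
          / risingFactorial (θ + 1) (∑ i ∈ s, n i - 1)) := by
  have hmeas := measurable_distinctSum_ofReal s n
  have hcard := Finset.card_pos.mpr hs
  unfold poissonDirichlet
  split_ifs with hθ
  · rw [lintegral_dirac' _ hmeas, distinctSum_single s hn hs, hθ]
    split_ifs with h1
    · obtain ⟨a, rfl⟩ := Finset.card_eq_one.mp h1
      have : ((n a - 1).factorial : ℝ) ≠ 0 := by positivity
      simp [risingFactorial_one, this]
    · rw [NNReal.coe_zero, zero_pow (by omega), zero_mul, zero_div, ENNReal.ofReal_zero]
  · have ht : 0 < (θ : ℝ) := NNReal.coe_pos.mpr (pos_iff_ne_zero.mpr hθ)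
    rw [lintegral_map hmeas measurable_decreasingRearrangement, gemMeasure,
      lintegral_map (f := fun a => distinctSum s n fun c =>
        ENNReal.ofReal (decreasingRearrangement a c))
        (hmeas.comp measurable_decreasingRearrangement) measurable_stickBreaking]
    have hcongr : ∀ᵐ v ∂(Measure.infinitePi fun _ : ℕ => betaMeasure 1 (θ : ℝ)),
        distinctSum s n
            (fun c => ENNReal.ofReal (decreasingRearrangement (stickBreaking v) c))
          = distinctSum s n (fun c => ENNReal.ofReal (stickBreaking v c)) := by
      filter_upwards [ae_forall_mem_Ioo_infinitePi ht] with v hv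
      have hpos := stickBreaking_pos hv
      have hlim : Filter.Tendsto (stickBreaking v) Filter.atTop (nhds 0) :=
        (summable_of_sum_range_le (fun c => (hpos c).le)
          (sum_stickBreaking_le_one hv)).tendsto_atTop_zero
      rw [← distinctSum_comp_equiv s n (Equiv.ofBijective _ (bijective_decreasingRank hpos hlim))]
      simp only [Equiv.ofBijective_apply, decreasingRearrangement_decreasingRank hpos hlim]
    rw [lintegral_congr_ae hcongr]
    refine (gemMoment_eq ht s hn).trans ?_
    obtain ⟨i₀, hi₀⟩ := hs
    obtain ⟨M, hM⟩ : ∃ M, ∑ i ∈ s, n i = M + 1 := by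
      have h1 : n i₀ ≤ ∑ i ∈ s, n i := Finset.single_le_sum (fun _ _ => Nat.zero_le _) hi₀
      have := hn i₀ hi₀
      exact ⟨∑ i ∈ s, n i - 1, by omega⟩
    obtain ⟨k, hk⟩ : ∃ k, s.card = k + 1 := ⟨s.card - 1, by omega⟩
    have hr := risingFactorial_pos (add_pos ht one_pos) M
    rw [hM, hk, risingFactorial_succ', Nat.add_sub_cancel, Nat.add_sub_cancel, pow_succ]
    congr 1
    field_simp

end PoissonDirichletMoment


/-! ### The parameters of a virtual permutation -/

theorem extendLast_castSucc {N : ℕ} (σ : Equiv.Perm (Fin N)) (k : Fin N) :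
    extendLast σ k.castSucc = (σ k).castSucc := by
  simp [extendLast, Equiv.permCongr_apply]

theorem extendLast_last {N : ℕ} (σ : Equiv.Perm (Fin N)) :
    extendLast σ (Fin.last N) = Fin.last N := by
  simp [extendLast, Equiv.permCongr_apply]

theorem swap_mul_extendLast_last {N : ℕ} (a : Fin (N + 1)) (σ : Equiv.Perm (Fin N)) :
    (Equiv.swap (Fin.last N) a * extendLast σ) (Fin.last N) = a := by
  simp [extendLast_last]

theorem swap_mul_extendLast_castSucc {N : ℕ} (a : Fin (N + 1)) (σ : Equiv.Perm (Fin N))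
    (k : Fin N) : (Equiv.swap (Fin.last N) a * extendLast σ) k.castSucc
      = if (σ k).castSucc = a then Fin.last N else (σ k).castSucc := by
  rw [Equiv.Perm.mul_apply, extendLast_castSucc]
  split_ifs with h
  · rw [h, Equiv.swap_apply_right]
  · exact Equiv.swap_apply_of_ne_of_ne (Fin.castSucc_lt_last _).ne h

/-- Removing the last letter loses only its image. Thus the parameters of any virtual permutation
can be read off and determine it. -/
theorem swap_mul_extendLast_removeLast {N : ℕ} (τ : Equiv.Perm (Fin (N + 1))) :
    Equiv.swap (Fin.last N) (τ (Fin.last N)) * extendLast (removeLast τ) = τ := by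
  ext1 k
  induction k using Fin.lastCases with
  | last => rw [swap_mul_extendLast_last]
  | cast k =>
    rw [swap_mul_extendLast_castSucc, castSucc_removeLast]
    have hk : τ k.castSucc ≠ τ (Fin.last N) := fun h =>
      (Fin.castSucc_lt_last k).ne (τ.injective h)
    by_cases h : τ k.castSucc = Fin.last N
    · rw [if_pos h, if_pos rfl, h]
    · rw [if_neg h, if_neg hk]

/-- The parameters of a virtual permutation: the images of the last letters. -/
def chineseParam (v : VirtualPermutation) (j : ℕ) : Fin (j + 1) := v.1 (j + 1) (Fin.last j)

theorem measurable_chineseParam : Measurable chineseParam :=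
  measurable_pi_lambda _ fun j =>
    (Measurable.of_discrete (f := fun σ : Equiv.Perm (Fin (j + 1)) => σ (Fin.last j))).comp
      ((measurable_pi_apply (j + 1)).comp measurable_subtype_coe)

theorem chinesePerm_chineseParam (v : VirtualPermutation) (N : ℕ) :
    chinesePerm (chineseParam v) N = v.1 N := by
  induction N with
  | zero => exact Subsingleton.elim _ _
  | succ N ih =>
    rw [chinesePerm, ih, ← v.2 N]
    exact swap_mul_extendLast_removeLast (v.1 (N + 1))

theorem chineseVirtual_chineseParam (v : VirtualPermutation) :
    chineseVirtual (chineseParam v) = v :=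
  Subtype.ext (funext fun N => chinesePerm_chineseParam v N)

theorem chinesePerm_eq_iff {m m' : (j : ℕ) → Fin (j + 1)} {N : ℕ} :
    chinesePerm m N = chinesePerm m' N ↔ ∀ j < N, m j = m' j := by
  induction N with
  | zero => simp [chinesePerm]
  | succ N ih =>
    constructor
    · intro h
      have h1 := congrArg removeLast h
      rw [chinesePerm, chinesePerm, removeLast_swap_mul, removeLast_swap_mul, ih] at h1
      have h2 := congrArg (fun σ : Equiv.Perm (Fin (N + 1)) => σ (Fin.last N)) h
      simp only [chinesePerm, swap_mul_extendLast_last] at h2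
      intro j hj
      rcases Nat.lt_succ_iff_lt_or_eq.mp hj with hj | rfl
      · exact h1 j hj
      · exact h2
    · intro h
      rw [chinesePerm, chinesePerm, ih.mpr fun j hj => h j (by omega), h N (by omega)]

theorem apply_eq_chinesePerm_iff (v : VirtualPermutation) (m : (j : ℕ) → Fin (j + 1)) (N : ℕ) :
    v.1 N = chinesePerm m N ↔ ∀ j < N, chineseParam v j = m j := by
  rw [← chinesePerm_chineseParam, chinesePerm_eq_iff]

/-! ### The cycles of a virtual permutation, in terms of its parameters -/

section Cycles

variable (m : (j : ℕ) → Fin (j + 1))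

theorem val_lt_of_ne_last {i : ℕ} (h : m i ≠ Fin.last i) : (m i : ℕ) < i :=
  Fin.val_lt_last h

/-- The smallest letter of the cycle of `i`. -/
def cycleRoot (i : ℕ) : ℕ :=
  if h : m i = Fin.last i then i
  else
    have := val_lt_of_ne_last m h
    cycleRoot (m i)
termination_by i

/-- The smallest letters of the cycles of the permutation of `N` letters. -/
def cycleRoots (N : ℕ) : Finset ℕ := (Finset.range N).filter fun i => m i = Fin.last i

/-- The number of letters of the cycle with smallest letter `q`. -/
def cycleSize (N q : ℕ) : ℕ := ((Finset.range N).filter fun i => cycleRoot m i = q).card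

/-- The number of permutations of `N` letters with the same cycles, as sets of letters. -/
def cycleArrangements (N : ℕ) : ℕ := ∏ q ∈ cycleRoots m N, (cycleSize m N q - 1).factorial

/-- The function `f` separates the cycles of the permutation of `N` letters, and is constant on
each of them. -/
def LabelsCycles (N : ℕ) (f : ℕ → ℕ) : Prop :=
  ∀ i < N, ∀ i' < N, f i = f i' ↔ cycleRoot m i = cycleRoot m i'

variable {m}

theorem cycleRoot_of_eq_last {i : ℕ} (h : m i = Fin.last i) : cycleRoot m i = i := by
  rw [cycleRoot, dif_pos h]

theorem cycleRoot_of_ne_last {i : ℕ} (h : m i ≠ Fin.last i) :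
    cycleRoot m i = cycleRoot m (m i) := by
  rw [cycleRoot, dif_neg h]

theorem cycleRoot_apply (i : ℕ) : cycleRoot m (m i) = cycleRoot m i := by
  by_cases h : m i = Fin.last i
  · rw [h, Fin.val_last]
  · exact (cycleRoot_of_ne_last h).symm

theorem cycleRoot_le (i : ℕ) : cycleRoot m i ≤ i := by
  induction i using Nat.strong_induction_on with
  | _ i ih =>
    by_cases h : m i = Fin.last i
    · exact (cycleRoot_of_eq_last h).le
    · rw [cycleRoot_of_ne_last h]
      exact (ih _ (val_lt_of_ne_last m h)).trans (val_lt_of_ne_last m h).le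

theorem apply_cycleRoot (i : ℕ) : m (cycleRoot m i) = Fin.last (cycleRoot m i) := by
  induction i using Nat.strong_induction_on with
  | _ i ih =>
    by_cases h : m i = Fin.last i
    · rw [cycleRoot_of_eq_last h, h]
    · rw [cycleRoot_of_ne_last h]
      exact ih _ (val_lt_of_ne_last m h)

theorem mem_cycleRoots {N q : ℕ} : q ∈ cycleRoots m N ↔ q < N ∧ m q = Fin.last q := by
  simp [cycleRoots]

theorem cycleRoot_mem_cycleRoots {N i : ℕ} (h : i < N) : cycleRoot m i ∈ cycleRoots m N :=
  mem_cycleRoots.mpr ⟨(cycleRoot_le i).trans_lt h, apply_cycleRoot i⟩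

theorem cycleRoot_eq_self_of_mem {N q : ℕ} (h : q ∈ cycleRoots m N) : cycleRoot m q = q :=
  cycleRoot_of_eq_last (mem_cycleRoots.mp h).2

theorem cycleSize_succ (N q : ℕ) :
    cycleSize m (N + 1) q = cycleSize m N q + if cycleRoot m N = q then 1 else 0 := by
  rw [cycleSize, Finset.range_add_one, Finset.filter_insert]
  split_ifs with h
  · rw [Finset.card_insert_of_notMem (by simp)]
    rfl
  · rfl

theorem cycleSize_self (N : ℕ) : cycleSize m N N = 0 := by
  rw [cycleSize, Finset.card_eq_zero, Finset.filter_eq_empty_iff]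
  intro i hi
  exact ((cycleRoot_le i).trans_lt (Finset.mem_range.mp hi)).ne

theorem cycleSize_ne_zero {N q : ℕ} (h : q ∈ cycleRoots m N) : cycleSize m N q ≠ 0 := by
  rw [cycleSize, Finset.card_ne_zero]
  exact ⟨q, Finset.mem_filter.mpr
    ⟨Finset.mem_range.mpr (mem_cycleRoots.mp h).1, cycleRoot_eq_self_of_mem h⟩⟩

theorem sum_cycleSize (N : ℕ) : ∑ q ∈ cycleRoots m N, cycleSize m N q = N := by
  have := Finset.card_eq_sum_card_fiberwise (f := cycleRoot m) (s := Finset.range N)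
    (t := cycleRoots m N) fun i hi => cycleRoot_mem_cycleRoots (by simpa using hi)
  rw [Finset.card_range] at this
  exact this.symm

theorem cycleRoots_succ (N : ℕ) : cycleRoots m (N + 1)
    = if m N = Fin.last N then insert N (cycleRoots m N) else cycleRoots m N := by
  rw [cycleRoots, Finset.range_add_one, Finset.filter_insert]
  rfl

theorem notMem_cycleRoots_self (N : ℕ) : N ∉ cycleRoots m N := fun h =>
  (mem_cycleRoots.mp h).1.false

theorem cycleArrangements_succ_of_eq_last {N : ℕ} (h : m N = Fin.last N) :
    cycleArrangements m (N + 1) = cycleArrangements m N := by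
  rw [cycleArrangements, cycleRoots_succ, if_pos h,
    Finset.prod_insert (notMem_cycleRoots_self N), cycleSize_succ, cycleSize_self,
    cycleRoot_of_eq_last h, if_pos rfl, Nat.zero_add, Nat.sub_self, Nat.factorial_zero, one_mul]
  refine Finset.prod_congr rfl fun q hq => ?_
  rw [cycleSize_succ, cycleRoot_of_eq_last h, if_neg (mem_cycleRoots.mp hq).1.ne', add_zero]

/-- A cycle with n letters offers n places for the new one: (n-1)! becomes n!. -/
theorem cycleArrangements_succ_of_ne_last {N : ℕ} (h : m N ≠ Fin.last N) :
    cycleArrangements m (N + 1) = cycleSize m N (cycleRoot m N) * cycleArrangements m N := by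
  have hq : cycleRoot m N ∈ cycleRoots m N := by
    rw [cycleRoot_of_ne_last h]
    exact cycleRoot_mem_cycleRoots (val_lt_of_ne_last m h)
  rw [cycleArrangements, cycleArrangements, cycleRoots_succ, if_neg h,
    ← Finset.mul_prod_erase _ _ hq, ← Finset.mul_prod_erase _ _ hq, ← mul_assoc]
  congr 1
  · rw [cycleSize_succ, if_pos rfl, Nat.add_sub_cancel,
      Nat.mul_factorial_pred (cycleSize_ne_zero hq)]
  · refine Finset.prod_congr rfl fun q hq => ?_
    rw [cycleSize_succ, if_neg (Finset.ne_of_mem_erase hq).symm, add_zero]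

theorem cycleArrangements_ne_zero (N : ℕ) : cycleArrangements m N ≠ 0 :=
  Finset.prod_ne_zero_iff.mpr fun _ _ => Nat.factorial_ne_zero _

theorem labelsCycles_succ_iff {N : ℕ} {f : ℕ → ℕ} :
    LabelsCycles m (N + 1) f ↔ LabelsCycles m N f ∧
      if m N = Fin.last N then ∀ i < N, f i ≠ f N else f N = f (m N) := by
  constructor
  · intro h
    refine ⟨fun i hi i' hi' => h i (by omega) i' (by omega), ?_⟩
    split_ifs with hl
    · intro i hi hf
      have h1 := (h i (by omega) N (by omega)).mp hf
      rw [cycleRoot_of_eq_last hl] at h1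
      exact ((cycleRoot_le i).trans_lt hi).ne h1
    · exact (h N (by omega) _ (m N).isLt).mpr (cycleRoot_of_ne_last hl)
  · rintro ⟨h, hN⟩
    have key : ∀ i < N, f i = f N ↔ cycleRoot m i = cycleRoot m N := by
      intro i hi
      split_ifs at hN with hl
      · rw [cycleRoot_of_eq_last hl]
        exact iff_of_false (hN i hi) ((cycleRoot_le i).trans_lt hi).ne
      · rw [hN, cycleRoot_of_ne_last hl]
        exact h i hi _ (val_lt_of_ne_last m hl)
    intro i hi i' hi'
    rcases Nat.lt_succ_iff_lt_or_eq.mp hi with hi | rfl <;>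
      rcases Nat.lt_succ_iff_lt_or_eq.mp hi' with hi' | rfl
    · exact h i hi i' hi'
    · exact key i hi
    · rw [eq_comm, key i' hi', eq_comm]
    · simp

theorem cycleRoot_chinesePerm {N : ℕ} (k : Fin N) :
    cycleRoot m (chinesePerm m N k) = cycleRoot m k := by
  induction N with
  | zero => exact k.elim0
  | succ N ih =>
    rw [chinesePerm]
    induction k using Fin.lastCases with
    | last => rw [swap_mul_extendLast_last, cycleRoot_apply, Fin.val_last]
    | cast k =>
      rw [swap_mul_extendLast_castSucc]
      split_ifs with h
      · rw [Fin.val_last, ← cycleRoot_apply, ← h, Fin.val_castSucc, ih, Fin.val_castSucc]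
      · rw [Fin.val_castSucc, ih, Fin.val_castSucc]

theorem LabelsCycles.apply_chinesePerm {N : ℕ} {f : ℕ → ℕ} (hf : LabelsCycles m N f) (k : Fin N) :
    f (chinesePerm m N k) = f k :=
  (hf _ (Fin.isLt _) _ (Fin.isLt _)).mpr (cycleRoot_chinesePerm k)

/-- Together with `cycleRoot_chinesePerm`, this shows that the fibres of `cycleRoot` are exactly the
cycles: every invariant function factors through it. -/
theorem apply_eq_apply_cycleRoot {α : Type*} {N : ℕ} {h : Fin N → α}
    (hh : ∀ k, h (chinesePerm m N k) = h k) (i : Fin N) :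
    h i = h ⟨cycleRoot m i, (cycleRoot_le _).trans_lt i.isLt⟩ := by
  induction N with
  | zero => exact i.elim0
  | succ N ih =>
    have hlast := hh (Fin.last N)
    rw [chinesePerm, swap_mul_extendLast_last] at hlast
    have hcast : ∀ k : Fin N, h (chinesePerm m N k).castSucc = h k.castSucc := by
      intro k
      have hk := hh k.castSucc
      rw [chinesePerm, swap_mul_extendLast_castSucc] at hk
      split_ifs at hk with h1
      · rw [h1, hlast, hk]
      · exact hk
    have ih' : ∀ k : Fin N, h k.castSucc
        = h (Fin.castSucc ⟨cycleRoot m k, (cycleRoot_le _).trans_lt k.isLt⟩) := fun k =>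
      ih (h := fun k => h k.castSucc) hcast k
    induction i using Fin.lastCases with
    | last =>
      by_cases hl : m N = Fin.last N
      · congr 1
        ext
        exact (cycleRoot_of_eq_last hl).symm
      · rw [← hlast]
        obtain ⟨b, hb⟩ := Fin.exists_castSucc_eq.mpr hl
        have h2 := ih' b
        rw [← hb, h2]
        congr 1
        ext
        simp only [Fin.castSucc_mk, Fin.val_last]
        rw [cycleRoot_of_ne_last hl, ← hb, Fin.val_castSucc]
    | cast k => exact ih' k

theorem LabelsCycles.eq_of_invariant {α : Type*} {N : ℕ} {f : ℕ → ℕ} (hf : LabelsCycles m N f)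
    {h : Fin N → α} (hh : ∀ k, h (chinesePerm m N k) = h k) {i i' : Fin N} (hi : f i = f i') :
    h i = h i' := by
  rw [apply_eq_apply_cycleRoot hh i, apply_eq_apply_cycleRoot hh i']
  congr 1
  ext
  exact (hf i i.isLt i' i'.isLt).mp hi

theorem LabelsCycles.card_filter {N : ℕ} {f : ℕ → ℕ} (hf : LabelsCycles m N f) {i : ℕ}
    (hi : i < N) : (Finset.univ.filter fun b : Fin N => f b = f i).card
      = cycleSize m N (cycleRoot m i) := by
  rw [cycleSize, ← Finset.card_map Fin.valEmbedding]
  congr 1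
  ext b
  simp only [Finset.mem_map, Finset.mem_filter, Finset.mem_univ, true_and, Fin.valEmbedding_apply,
    Finset.mem_range]
  constructor
  · rintro ⟨b, hb, rfl⟩
    exact ⟨b.isLt, (hf b b.isLt i hi).mp hb⟩
  · rintro ⟨hb, h⟩
    exact ⟨⟨b, hb⟩, (hf b hb i hi).mpr h, rfl⟩

end Cycles


/-! ### Measurability of the cyclic arrangement of points on circles -/

theorem measurable_eval_eval {T : Type*} [MeasurableSpace T] :
    Measurable fun p : (ℕ → T) × ℕ => p.1 p.2 :=
  measurable_from_prod_countable_left fun j => measurable_pi_apply j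

theorem measurable_circle_length (k : ℕ) :
    Measurable fun p : (ℕ → ℝ) × (ℕ → ℕ × ℝ) => p.1 (p.2 k).1 :=
  measurable_eval_eval.comp (measurable_fst.prodMk
    (measurable_fst.comp ((measurable_pi_apply k).comp measurable_snd)))

theorem measurableSet_isNextPoint {N : ℕ} (k m : Fin N) :
    MeasurableSet {p : (ℕ → ℝ) × (ℕ → ℕ × ℝ) | IsNextPoint p.1 p.2 k m} := by
  have h1 : ∀ i : ℕ, Measurable fun p : (ℕ → ℝ) × (ℕ → ℕ × ℝ) => (p.2 i).1 := fun i => by fun_prop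
  have h2 : ∀ i : ℕ, Measurable fun p : (ℕ → ℝ) × (ℕ → ℕ × ℝ) => (p.2 i).2 := fun i => by fun_prop
  have harc : ∀ i : ℕ, Measurable fun p : (ℕ → ℝ) × (ℕ → ℕ × ℝ) =>
      arcLength (p.1 (p.2 k).1) (p.2 k).2 (p.2 i).2 := fun i =>
    Measurable.ite (measurableSet_lt (h2 k) (h2 i)) ((h2 i).sub (h2 k))
      (((h2 i).sub (h2 k)).add (measurable_circle_length k))
  have heq : ∀ i : ℕ, MeasurableSet {p : (ℕ → ℝ) × (ℕ → ℕ × ℝ) | (p.2 i).1 = (p.2 k).1} :=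
    fun i => measurableSet_eq_fun (h1 i) (h1 k)
  have h : {p : (ℕ → ℝ) × (ℕ → ℕ × ℝ) | IsNextPoint p.1 p.2 k m}
      = {p | (p.2 m).1 = (p.2 k).1} ∩ ⋂ i : Fin N, ({p | (p.2 i).1 = (p.2 k).1}ᶜ ∪
        {p | arcLength (p.1 (p.2 k).1) (p.2 k).2 (p.2 m).2
          ≤ arcLength (p.1 (p.2 k).1) (p.2 k).2 (p.2 i).2}) := by
    ext p
    simp [IsNextPoint, imp_iff_not_or]
  rw [h]
  exact (heq m).inter (MeasurableSet.iInter fun i =>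
    (heq i).compl.union (measurableSet_le (harc m) (harc i)))

theorem distinctOnCircles_iff {l : ℕ → ℝ} {x : ℕ → ℕ × ℝ} :
    DistinctOnCircles l x ↔ (∀ k, 0 ≤ (x k).2 ∧ (x k).2 < l (x k).1) ∧ ∀ i j, i ≠ j → x i ≠ x j :=
  ⟨fun h => ⟨h.mem, fun _ _ hij => h.injective.ne hij⟩,
    fun h => ⟨h.1, fun i j hij => by_contra fun hne => h.2 i j hne hij⟩⟩

theorem measurableSet_distinctOnCircles :
    MeasurableSet {p : (ℕ → ℝ) × (ℕ → ℕ × ℝ) | DistinctOnCircles p.1 p.2} := by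
  have h2 : ∀ i : ℕ, Measurable fun p : (ℕ → ℝ) × (ℕ → ℕ × ℝ) => (p.2 i).2 := fun i => by fun_prop
  have h : {p : (ℕ → ℝ) × (ℕ → ℕ × ℝ) | DistinctOnCircles p.1 p.2}
      = (⋂ k : ℕ, {p | 0 ≤ (p.2 k).2} ∩ {p | (p.2 k).2 < p.1 (p.2 k).1})
        ∩ ⋂ i : ℕ, ⋂ j : ℕ, ⋂ _ : i ≠ j, {p | p.2 i = p.2 j}ᶜ := by
    ext p
    simp only [Set.mem_ofPred_eq, distinctOnCircles_iff, Set.mem_inter_iff, Set.mem_iInter,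
      Set.mem_compl_iff, ne_eq]
  rw [h]
  refine (MeasurableSet.iInter fun k => (measurableSet_le measurable_const (h2 k)).inter
    (measurableSet_lt (h2 k) (measurable_circle_length k))).inter ?_
  refine MeasurableSet.iInter fun i => MeasurableSet.iInter fun j => MeasurableSet.iInter fun _ => ?_
  exact (measurableSet_eq_fun (by fun_prop) (by fun_prop)).compl

theorem DistinctOnCircles.perm_eq_iff {l : ℕ → ℝ} {x : ℕ → ℕ × ℝ} (h : DistinctOnCircles l x)
    {N : ℕ} {σ : Equiv.Perm (Fin N)} :
    h.perm N = σ ↔ ∀ k : Fin N, IsNextPoint l x k (σ k) := by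
  constructor
  · rintro rfl k
    exact h.isNextPoint_perm k
  · intro hσ
    ext1 k
    exact h.isNextPoint_unique (h.isNextPoint_perm k) (hσ k)

/-- Returning to the starting point takes a full turn, and any other point of the same circle would
be met strictly earlier. -/
theorem DistinctOnCircles.ne_of_perm_last {l : ℕ → ℝ} {x : ℕ → ℕ × ℝ} (h : DistinctOnCircles l x)
    {N : ℕ} (hN : h.perm (N + 1) (Fin.last N) = Fin.last N) {i : ℕ} (hi : i < N) :
    (x i).1 ≠ (x N).1 := by
  intro hc
  have h1 := (h.isNextPoint_perm (Fin.last N)).2 ⟨i, by omega⟩ hc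
  rw [hN] at h1
  simp only [Fin.val_last] at h1
  have hne : (x N).2 ≠ (x i).2 := fun hs => hi.ne (h.injective (Prod.ext hc hs.symm))
  obtain ⟨a, b⟩ := h.mem N
  obtain ⟨a', b'⟩ := h.mem i
  rw [hc] at b'
  unfold arcLength at h1
  rcases lt_or_gt_of_ne hne with hlt | hlt <;> split_ifs at h1 <;> linarith

theorem DistinctOnCircles.labelsCycles {l : ℕ → ℝ} {x : ℕ → ℕ × ℝ} (h : DistinctOnCircles l x)
    {m : (j : ℕ) → Fin (j + 1)} {N : ℕ} (hN : h.perm N = chinesePerm m N) :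
    LabelsCycles m N (fun i => (x i).1) := by
  induction N with
  | zero => exact fun i hi => absurd hi (Nat.not_lt_zero i)
  | succ N ih =>
    have hN' : h.perm N = chinesePerm m N := by
      rw [← h.removeLast_perm, hN, chinesePerm, removeLast_swap_mul]
    have hlast : h.perm (N + 1) (Fin.last N) = m N := by
      rw [hN, chinesePerm, swap_mul_extendLast_last]
    refine labelsCycles_succ_iff.mpr ⟨ih hN', ?_⟩
    split_ifs with hm
    · exact fun i hi => h.ne_of_perm_last (hlast.trans hm) hi
    · have := (h.isNextPoint_perm (Fin.last N)).1
      rw [hlast] at this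
      exact this.symm

/-- The points `x 0, …, x (N - 1)` lie on the circles `f 0, …, f (N - 1)`, and their cyclic
arrangement is described by the permutation `σ`. -/
def arrangementEvent (l : ℕ → ℝ) {N : ℕ} (σ : Equiv.Perm (Fin N)) (f : ℕ → ℕ) :
    Set (ℕ → ℕ × ℝ) :=
  {x | (∀ k : Fin N, (x k).1 = f k) ∧ ∀ k : Fin N, IsNextPoint l x k (σ k)}

theorem measurableSet_arrangementEvent (l : ℕ → ℝ) {N : ℕ} (σ : Equiv.Perm (Fin N))
    (f : ℕ → ℕ) : MeasurableSet (arrangementEvent l σ f) := by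
  have h : arrangementEvent l σ f = (⋂ k : Fin N, {x | (x k).1 = f k})
      ∩ ⋂ k : Fin N, (fun x => (l, x)) ⁻¹'
        {p : (ℕ → ℝ) × (ℕ → ℕ × ℝ) | IsNextPoint p.1 p.2 k (σ k)} := by
    ext x
    simp [arrangementEvent]
  rw [h]
  exact (MeasurableSet.iInter fun k => measurableSet_eq_fun (by fun_prop) measurable_const).inter
    (MeasurableSet.iInter fun k => measurable_prodMk_left (measurableSet_isNextPoint k (σ k)))

theorem LabelsCycles.congr {m : (j : ℕ) → Fin (j + 1)} {N : ℕ} {f g : ℕ → ℕ}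
    (h : LabelsCycles m N f) (hfg : ∀ i < N, f i = g i) : LabelsCycles m N g := by
  intro i hi i' hi'
  rw [← hfg i hi, ← hfg i' hi']
  exact h i hi i' hi'

theorem isNextPoint_comp_viaEmbedding {l : ℕ → ℝ} {x : ℕ → ℕ × ℝ} {N : ℕ}
    (π : Equiv.Perm (Fin N)) (k m : Fin N) :
    IsNextPoint l (fun i => x (π.viaEmbedding Fin.valEmbedding i)) k m
      ↔ IsNextPoint l x (π k) (π m) := by
  have h : ∀ i : Fin N, π.viaEmbedding Fin.valEmbedding (i : ℕ) = π i := fun i =>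
    Equiv.Perm.viaEmbedding_apply π Fin.valEmbedding i
  simp only [IsNextPoint, h]
  refine and_congr_right fun _ => ?_
  exact π.forall_congr_right (q := fun i : Fin N => (x i).1 = (x (π k)).1 →
    arcLength (l (x (π k)).1) (x (π k)).2 (x (π m)).2
      ≤ arcLength (l (x (π k)).1) (x (π k)).2 (x i).2)

/-! ### Independent points on circles of given perimeters -/

/-- Independence of coordinate N from an event depending only on the coordinates below N. -/
theorem infinitePi_inter_eval {T : Type*} [MeasurableSpace T] (μ : Measure T)
    [IsProbabilityMeasure μ] {N : ℕ} {E : Set (ℕ → T)} (hE : MeasurableSet E)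
    (hdep : ∀ x y : ℕ → T, (∀ i < N, x i = y i) → x ∈ E → y ∈ E) {C : Set T}
    (hC : MeasurableSet C) :
    Measure.infinitePi (fun _ : ℕ => μ) (E ∩ {x | x N ∈ C})
      = Measure.infinitePi (fun _ : ℕ => μ) E * μ C := by
  obtain ⟨t₀⟩ : Nonempty T := nonempty_of_isProbabilityMeasure μ
  -- Padding by an arbitrary point exhibits `E` as the preimage of a measurable set of finite
  -- sequences.
  let F : (Finset.range N → T) → (ℕ → T) := fun y i =>
    if h : i ∈ Finset.range N then y ⟨i, h⟩ else t₀
  have hF : Measurable F := by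
    refine measurable_pi_lambda _ fun i => ?_
    by_cases h : i ∈ Finset.range N
    · simpa only [F, dif_pos h] using measurable_pi_apply _
    · simpa only [F, dif_neg h] using measurable_const
  have hFE : E = (fun x (i : Finset.range N) => x i) ⁻¹' (F ⁻¹' E) := by
    ext x
    have hx : ∀ i < N, F (fun i : Finset.range N => x i) i = x i := fun i hi => by
      simp only [F, dif_pos (Finset.mem_range.mpr hi)]
    exact ⟨hdep _ _ fun i hi => (hx i hi).symm, hdep _ _ hx⟩
  have hind := (iIndepFun_infinitePi (P := fun _ : ℕ => μ) (X := fun _ t => t)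
    fun _ => measurable_id).indepFun_finset (Finset.range N) {N} (by simp)
      fun i => measurable_pi_apply i
  have h := hind.measure_inter_preimage_eq_mul (F ⁻¹' E)
    ((fun y => y ⟨N, Finset.mem_singleton_self N⟩) ⁻¹' C) (hF hE) (measurable_pi_apply _ hC)
  rw [← hFE] at h
  refine h.trans (congrArg _ ?_)
  exact (measurePreserving_eval_infinitePi (fun _ : ℕ => μ) N).measure_preimage hC.nullMeasurableSet

section FixedCircles

variable {l : ℕ → ℝ} {μ : Measure (ℕ × ℝ)}

theorem measurableSet_circleUnion (l : ℕ → ℝ) : MeasurableSet (circleUnion l) :=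
  (measurableSet_le measurable_const measurable_snd).inter
    (measurableSet_lt measurable_snd ((Measurable.of_discrete (f := l)).comp measurable_fst))

theorem ae_mem_circleUnion (hac : μ ≪ circleLebesgue l) : ∀ᵐ p ∂μ, p ∈ circleUnion l :=
  hac.ae_le (ae_restrict_mem (measurableSet_circleUnion l))

theorem measure_singleton_of_ac (hac : μ ≪ circleLebesgue l) (p : ℕ × ℝ) : μ {p} = 0 := by
  refine hac (Measure.restrict_le_self.absolutelyContinuous ?_)
  rw [← Prod.mk.eta (p := p), ← Set.singleton_prod_singleton, Measure.prod_prod]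
  simp

theorem measure_circle (hac : μ ≪ circleLebesgue l)
    (hmass : ∀ j, μ (circleSet l j) = ENNReal.ofReal (l j)) (j : ℕ) :
    μ (Prod.fst ⁻¹' {j}) = ENNReal.ofReal (l j) := by
  rw [← hmass]
  refine measure_congr ?_
  filter_upwards [ae_mem_circleUnion hac] with p hp
  refine propext ⟨?_, fun h => h.1⟩
  rintro rfl
  exact ⟨rfl, hp⟩

variable [IsProbabilityMeasure μ]

/-- Absolute continuity puts the points on the circles and excludes atoms; by Fubini the diagonal is
then null for each pair. -/
theorem ae_distinctOnCircles (hac : μ ≪ circleLebesgue l) :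
    ∀ᵐ x ∂(Measure.infinitePi fun _ : ℕ => μ), DistinctOnCircles l x := by
  simp only [distinctOnCircles_iff]
  refine Filter.Eventually.and ?_ ?_
  · rw [ae_all_iff]
    intro k
    exact (measurePreserving_eval_infinitePi (fun _ : ℕ => μ) k).quasiMeasurePreserving.ae
      (ae_mem_circleUnion hac)
  · simp only [ae_all_iff]
    intro i j hij
    have hdiag : ∀ᵐ p ∂(μ.prod μ), p.1 ≠ p.2 := by
      rw [ae_iff]
      simp only [not_not]
      rw [Measure.measure_prod_null (measurableSet_eq_fun measurable_fst measurable_snd)]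
      refine Filter.Eventually.of_forall fun p => ?_
      refine measure_mono_null ?_ (measure_singleton_of_ac hac p)
      intro q hq
      exact (Eq.symm hq : q = p)
    rw [← Measure.infinitePi_map_eval_prod (P := fun _ : ℕ => μ) hij] at hdiag
    exact ae_of_ae_map (f := fun x : ℕ → ℕ × ℝ => (x i, x j)) (by fun_prop) hdiag

/-- Exchangeability: renaming the points by π conjugates their arrangement, and respects the circles
when `f` is π-invariant. -/
theorem measure_arrangementEvent_conj (l : ℕ → ℝ) {N : ℕ} (π τ : Equiv.Perm (Fin N)) {f : ℕ → ℕ}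
    (hf : ∀ k : Fin N, f (π k) = f k) :
    Measure.infinitePi (fun _ : ℕ => μ) (arrangementEvent l (π * τ * π⁻¹) f)
      = Measure.infinitePi (fun _ : ℕ => μ) (arrangementEvent l τ f) := by
  let ρ := π.viaEmbedding Fin.valEmbedding
  have hρ : ∀ i : Fin N, ρ (i : ℕ) = π i := fun i =>
    Equiv.Perm.viaEmbedding_apply π Fin.valEmbedding i
  have hmp : (Measure.infinitePi fun _ : ℕ => μ).map (fun x i => x (ρ i))
      = Measure.infinitePi fun _ : ℕ => μ :=
    Measure.map_infinitePi_infinitePi_of_inj (P := fun _ : ℕ => μ) ρ.injective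
  conv_rhs => rw [← hmp, Measure.map_apply (by fun_prop) (measurableSet_arrangementEvent l τ f)]
  congr 1
  ext x
  simp only [arrangementEvent, Set.mem_preimage, Set.mem_ofPred_eq]
  refine and_congr ?_ ?_
  · rw [← π.forall_congr_right]
    simp only [hρ, hf]
  · rw [← π.forall_congr_right]
    refine forall_congr' fun k => ?_
    rw [isNextPoint_comp_viaEmbedding]
    simp

/-- The new point is as likely to fall in the gap just before point `σ b` as in the gap just before
point b: conjugation by `extendLast σ` keeps the old arrangement and moves the new point to the next
gap. -/
theorem measure_arrangementEvent_insert (l : ℕ → ℝ) {N : ℕ} {σ : Equiv.Perm (Fin N)}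
    {f : ℕ → ℕ} (hf : ∀ k : Fin N, f (σ k) = f k) (b : Fin N) :
    Measure.infinitePi (fun _ : ℕ => μ)
        (arrangementEvent l (Equiv.swap (Fin.last N) (σ b).castSucc * extendLast σ) f)
      = Measure.infinitePi (fun _ : ℕ => μ)
        (arrangementEvent l (Equiv.swap (Fin.last N) b.castSucc * extendLast σ) f) := by
  rw [← measure_arrangementEvent_conj l (extendLast σ)
    (Equiv.swap (Fin.last N) b.castSucc * extendLast σ)]
  · rw [← mul_assoc, Equiv.mul_swap_eq_swap_mul, extendLast_last, extendLast_castSucc,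
      mul_inv_cancel_right]
  · intro k
    induction k using Fin.lastCases with
    | last => rw [extendLast_last]
    | cast k => rw [extendLast_castSucc]; exact hf k

theorem arrangementEvent_of_agree {N : ℕ} {σ : Equiv.Perm (Fin N)} {f : ℕ → ℕ}
    {x y : ℕ → ℕ × ℝ} (hxy : ∀ i < N, x i = y i) (hx : x ∈ arrangementEvent l σ f) :
    y ∈ arrangementEvent l σ f := by
  have h : ∀ i : Fin N, y i = x i := fun i => (hxy i i.isLt).symm
  simpa only [arrangementEvent, Set.mem_ofPred_eq, IsNextPoint, h] using hx

theorem mem_arrangementEvent_iff {x : ℕ → ℕ × ℝ} (h : DistinctOnCircles l x) {N : ℕ}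
    {σ : Equiv.Perm (Fin N)} {f : ℕ → ℕ} :
    x ∈ arrangementEvent l σ f ↔ (∀ k : Fin N, (x k).1 = f k) ∧ h.perm N = σ :=
  and_congr_right fun _ => h.perm_eq_iff.symm

theorem mem_arrangementEvent_succ_iff {x : ℕ → ℕ × ℝ} (h : DistinctOnCircles l x) {N : ℕ}
    {σ : Equiv.Perm (Fin N)} {f : ℕ → ℕ} (a : Fin (N + 1)) :
    x ∈ arrangementEvent l (Equiv.swap (Fin.last N) a * extendLast σ) f
      ↔ (x ∈ arrangementEvent l σ f ∧ (x N).1 = f N) ∧ h.perm (N + 1) (Fin.last N) = a := by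
  rw [mem_arrangementEvent_iff h, mem_arrangementEvent_iff h, Fin.forall_fin_succ']
  simp only [Fin.val_castSucc, Fin.val_last]
  constructor
  · rintro ⟨⟨h1, h2⟩, h3⟩
    refine ⟨⟨⟨h1, ?_⟩, h2⟩, ?_⟩
    · rw [← h.removeLast_perm, h3, removeLast_swap_mul]
    · rw [h3, swap_mul_extendLast_last]
  · rintro ⟨⟨⟨h1, h3⟩, h2⟩, h4⟩
    refine ⟨⟨h1, h2⟩, ?_⟩
    rw [← swap_mul_extendLast_removeLast (h.perm (N + 1)), h4, h.removeLast_perm, h3]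

/-- Insert the points one at a time. A point on its prescribed circle, already holding n > 0 points,
falls in each of the n gaps with equal probability; on an empty circle there is no choice. The
accumulated factors n form `cycleArrangements`. -/
theorem measure_arrangementEvent (hac : μ ≪ circleLebesgue l)
    (hmass : ∀ j, μ (circleSet l j) = ENNReal.ofReal (l j)) {m : (j : ℕ) → Fin (j + 1)} {N : ℕ}
    {f : ℕ → ℕ} (hf : LabelsCycles m N f) :
    Measure.infinitePi (fun _ : ℕ => μ) (arrangementEvent l (chinesePerm m N) f)
      = (∏ i ∈ Finset.range N, ENNReal.ofReal (l (f i))) / cycleArrangements m N := by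
  set ν := Measure.infinitePi fun _ : ℕ => μ
  induction N with
  | zero =>
    have : arrangementEvent l (chinesePerm m 0) f = Set.univ := by
      ext x
      simp [arrangementEvent]
    rw [this]
    simp [cycleArrangements, cycleRoots]
  | succ N ih =>
    obtain ⟨hfN, hlast⟩ := labelsCycles_succ_iff.mp hf
    have hgood := ae_distinctOnCircles hac
    set E := arrangementEvent l (chinesePerm m N) f ∩ {x | x N ∈ Prod.fst ⁻¹' {f N}} with hEdef
    have hE : ν E = (∏ i ∈ Finset.range N, ENNReal.ofReal (l (f i))) / cycleArrangements m N
        * ENNReal.ofReal (l (f N)) := by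
      rw [← ih hfN, ← measure_circle hac hmass]
      exact infinitePi_inter_eval μ (measurableSet_arrangementEvent l _ f)
        (fun x y hxy hx => arrangementEvent_of_agree hxy hx)
        (measurable_fst (measurableSet_singleton _))
    rw [Finset.prod_range_succ]
    by_cases hm : m N = Fin.last N
    · rw [if_pos hm] at hlast
      rw [cycleArrangements_succ_of_eq_last hm, ENNReal.mul_div_right_comm, ← hE]
      refine measure_congr ?_
      filter_upwards [hgood] with x hx
      refine propext ?_
      change x ∈ arrangementEvent l (Equiv.swap (Fin.last N) (m N) * extendLast (chinesePerm m N)) f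
        ↔ x ∈ E
      rw [mem_arrangementEvent_succ_iff hx]
      refine and_iff_left_of_imp fun hxE => ?_
      rw [hm]
      by_contra hne
      obtain ⟨b, hb⟩ := Fin.exists_castSucc_eq.mpr hne
      have h1 := (hx.isNextPoint_perm (Fin.last N)).1
      rw [← hb, Fin.val_castSucc, Fin.val_last, hxE.1.1 b, hxE.2] at h1
      exact hlast b b.isLt h1
    · rw [if_neg hm] at hlast
      -- The points already on the circle of the new one, each standing for the gap that precedes
      -- it.
      let B : Finset (Fin N) := Finset.univ.filter fun b => f b = f (m N)
      let A : Fin N → Set (ℕ → ℕ × ℝ) := fun b => arrangementEvent l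
        (Equiv.swap (Fin.last N) b.castSucc * extendLast (chinesePerm m N)) f
      have hmem : ∀ x, ∀ hx : DistinctOnCircles l x, ∀ b, x ∈ A b ↔
          x ∈ E ∧ hx.perm (N + 1) (Fin.last N) = b.castSucc := fun x hx b =>
        mem_arrangementEvent_succ_iff hx b.castSucc
      obtain ⟨b₀, hb₀⟩ := Fin.exists_castSucc_eq.mpr hm
      have hb₀val : (b₀ : ℕ) = m N := by rw [← hb₀, Fin.val_castSucc]
      have hunion : E =ᵐ[ν] ⋃ b ∈ B, A b := by
        filter_upwards [hgood] with x hx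
        refine propext ?_
        change x ∈ E ↔ x ∈ ⋃ b ∈ B, A b
        simp only [Set.mem_iUnion, hmem x hx, exists_prop, B, Finset.mem_filter, Finset.mem_univ,
          true_and]
        constructor
        · intro hxE
          have hne : hx.perm (N + 1) (Fin.last N) ≠ Fin.last N := fun hl => by
            refine hx.ne_of_perm_last hl b₀.isLt ?_
            rw [hxE.1.1 b₀, hb₀val, ← hlast]
            exact hxE.2.symm
          obtain ⟨b, hb⟩ := Fin.exists_castSucc_eq.mpr hne
          refine ⟨b, ?_, hxE, hb.symm⟩
          have h1 := (hx.isNextPoint_perm (Fin.last N)).1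
          rw [← hb, Fin.val_castSucc, Fin.val_last, hxE.1.1 b, hxE.2] at h1
          exact h1.trans hlast
        · rintro ⟨b, _, hxE, _⟩
          exact hxE
      have hdisj : (B : Set (Fin N)).Pairwise (Function.onFun (AEDisjoint ν) A) := by
        intro b _ b' _ hbb'
        refine measure_eq_zero_iff_ae_notMem.mpr ?_
        filter_upwards [hgood] with x hx hxA
        have h1 := ((hmem x hx b).mp hxA.1).2
        have h2 := ((hmem x hx b').mp hxA.2).2
        exact hbb' (Fin.castSucc_injective N (h1.symm.trans h2))
      have hconst : ∀ b ∈ B, ν (A b) = ν (A b₀) := by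
        intro b hb
        refine hfN.eq_of_invariant (h := fun b => ν (A b))
          (fun k => measure_arrangementEvent_insert l (fun k => hfN.apply_chinesePerm k) k) ?_
        rw [(Finset.mem_filter.mp hb).2, hb₀val]
      have hsum : ν E = cycleSize m N (cycleRoot m N) * ν (A b₀) := by
        rw [measure_congr hunion, measure_biUnion_finset₀ hdisj fun b _ =>
          (measurableSet_arrangementEvent l _ f).nullMeasurableSet,
          Finset.sum_congr rfl hconst, Finset.sum_const, nsmul_eq_mul,
          hfN.card_filter (val_lt_of_ne_last m hm), cycleRoot_apply]
      have hq : cycleSize m N (cycleRoot m N) ≠ 0 := by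
        refine cycleSize_ne_zero ?_
        rw [cycleRoot_of_ne_last hm]
        exact cycleRoot_mem_cycleRoots (val_lt_of_ne_last m hm)
      have hA : arrangementEvent l (chinesePerm m (N + 1)) f = A b₀ := by
        simp only [A, hb₀]
        rfl
      rw [hA, cycleArrangements_succ_of_ne_last hm, Nat.cast_mul]
      have hq' : (cycleSize m N (cycleRoot m N) : ℝ≥0∞) ≠ 0 := by exact_mod_cast hq
      have hc' : (cycleArrangements m N : ℝ≥0∞) ≠ 0 := by
        exact_mod_cast cycleArrangements_ne_zero N
      rw [ENNReal.eq_div_iff (mul_ne_zero hq' hc')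
        (ENNReal.mul_ne_top (ENNReal.natCast_ne_top _) (ENNReal.natCast_ne_top _)),
        mul_assoc, mul_left_comm, ← hsum, hE, ← mul_assoc, ENNReal.mul_div_cancel hc'
        (ENNReal.natCast_ne_top _)]

/-- The labelling of the letters which is constant on cycles, with given values on the cycles. -/
def extendLabels (m : (j : ℕ) → Fin (j + 1)) (N : ℕ) (j : cycleRoots m N → ℕ) (i : ℕ) : ℕ :=
  if h : cycleRoot m i ∈ cycleRoots m N then j ⟨cycleRoot m i, h⟩ else 0

theorem extendLabels_of_lt {m : (j : ℕ) → Fin (j + 1)} {N : ℕ} (j : cycleRoots m N → ℕ) {i : ℕ}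
    (hi : i < N) :
    extendLabels m N j i = j ⟨cycleRoot m i, cycleRoot_mem_cycleRoots hi⟩ :=
  dif_pos _

theorem extendLabels_root {m : (j : ℕ) → Fin (j + 1)} {N : ℕ} (j : cycleRoots m N → ℕ)
    (q : cycleRoots m N) : extendLabels m N j q = j q := by
  rw [extendLabels_of_lt j (mem_cycleRoots.mp q.2).1]
  congr 1
  exact Subtype.ext (cycleRoot_eq_self_of_mem q.2)

theorem labelsCycles_extendLabels_iff {m : (j : ℕ) → Fin (j + 1)} {N : ℕ}
    {j : cycleRoots m N → ℕ} :
    LabelsCycles m N (extendLabels m N j) ↔ Function.Injective j := by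
  constructor
  · intro h q q' hqq'
    rw [← extendLabels_root j q, ← extendLabels_root j q',
      h q (mem_cycleRoots.mp q.2).1 q' (mem_cycleRoots.mp q'.2).1,
      cycleRoot_eq_self_of_mem q.2, cycleRoot_eq_self_of_mem q'.2] at hqq'
    exact Subtype.ext hqq'
  · intro h i hi i' hi'
    rw [extendLabels_of_lt j hi, extendLabels_of_lt j hi', h.eq_iff, Subtype.mk.injEq]

theorem prod_extendLabels {m : (j : ℕ) → Fin (j + 1)} {N : ℕ} (j : cycleRoots m N → ℕ)
    (w : ℕ → ℝ≥0∞) : ∏ i ∈ Finset.range N, w (extendLabels m N j i)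
      = ∏ q : cycleRoots m N, w (j q) ^ cycleSize m N q := by
  rw [← Finset.prod_fiberwise_of_maps_to (g := cycleRoot m) (t := cycleRoots m N)
    fun i hi => cycleRoot_mem_cycleRoots (Finset.mem_range.mp hi), ← Finset.prod_coe_sort]
  refine Finset.prod_congr rfl fun q _ => ?_
  rw [cycleSize, ← Finset.prod_const]
  refine Finset.prod_congr rfl fun i hi => ?_
  obtain ⟨hi, hiq⟩ := Finset.mem_filter.mp hi
  rw [extendLabels_of_lt j (Finset.mem_range.mp hi)]
  congr 2
  exact Subtype.ext hiq

/-- Decompose according to the circle occupied by each cycle. Almost surely distinct cycles lie on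
distinct circles, so only injective assignments contribute. -/
theorem measure_isNextPoint_chinesePerm (hac : μ ≪ circleLebesgue l)
    (hmass : ∀ j, μ (circleSet l j) = ENNReal.ofReal (l j)) (m : (j : ℕ) → Fin (j + 1)) (N : ℕ) :
    Measure.infinitePi (fun _ : ℕ => μ) {x | ∀ k : Fin N, IsNextPoint l x k (chinesePerm m N k)}
      = distinctSum (cycleRoots m N) (cycleSize m N) (fun c => ENNReal.ofReal (l c))
        / cycleArrangements m N := by
  classical
  set ν := Measure.infinitePi fun _ : ℕ => μ
  let A : (cycleRoots m N → ℕ) → Set (ℕ → ℕ × ℝ) := fun j =>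
    arrangementEvent l (chinesePerm m N) (extendLabels m N j)
  have hgood := ae_distinctOnCircles hac
  have hlab : ∀ x, DistinctOnCircles l x → ∀ f, x ∈ arrangementEvent l (chinesePerm m N) f →
      LabelsCycles m N f := fun x hx f hxf =>
    (hx.labelsCycles (hx.perm_eq_iff.mpr hxf.2)).congr fun i hi => hxf.1 ⟨i, hi⟩
  have hunion : {x | ∀ k : Fin N, IsNextPoint l x k (chinesePerm m N k)} =ᵐ[ν] ⋃ j, A j := by
    filter_upwards [hgood] with x hx
    refine propext ?_
    change (∀ k : Fin N, IsNextPoint l x k (chinesePerm m N k)) ↔ x ∈ ⋃ j, A j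
    rw [Set.mem_iUnion]
    constructor
    · intro h
      have hl := hx.labelsCycles (hx.perm_eq_iff.mpr h)
      refine ⟨fun q => (x q).1, fun k => ?_, h⟩
      rw [extendLabels_of_lt _ k.isLt]
      refine (hl k k.isLt _ (mem_cycleRoots.mp (cycleRoot_mem_cycleRoots k.isLt)).1).mpr ?_
      exact (cycleRoot_eq_self_of_mem (cycleRoot_mem_cycleRoots k.isLt)).symm
    · rintro ⟨j, hj⟩
      exact hj.2
  have hdisj : Pairwise (Function.onFun Disjoint A) := by
    intro j j' hjj'
    refine Set.disjoint_left.mpr fun x hx hx' => hjj' (funext fun q => ?_)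
    have h1 := hx.1 ⟨q, (mem_cycleRoots.mp q.2).1⟩
    have h2 := hx'.1 ⟨q, (mem_cycleRoots.mp q.2).1⟩
    rw [← extendLabels_root j q, ← extendLabels_root j' q]
    exact h1.symm.trans h2
  rw [measure_congr hunion, measure_iUnion hdisj fun j => measurableSet_arrangementEvent l _ _,
    distinctSum, div_eq_mul_inv, ← ENNReal.tsum_mul_right]
  refine tsum_congr fun j => ?_
  split_ifs with hj
  · rw [← div_eq_mul_inv, ← prod_extendLabels j fun c => ENNReal.ofReal (l c)]
    exact measure_arrangementEvent hac hmass (labelsCycles_extendLabels_iff.mpr hj)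
  · rw [zero_mul]
    refine measure_eq_zero_iff_ae_notMem.mpr ?_
    filter_upwards [hgood] with x hx hxA
    exact hj (labelsCycles_extendLabels_iff.mp (hlab x hx _ hxA))

end FixedCircles


/-! ### Conditionally i.i.d. sequences and infinite products -/

theorem isPiSystem_squareCylinders_measurableSet {ι : Type*} {α : ι → Type*}
    [∀ i, MeasurableSpace (α i)] :
    IsPiSystem (squareCylinders fun i => {s : Set (α i) | MeasurableSet s}) :=
  isPiSystem_squareCylinders (fun _ => MeasurableSpace.isPiSystem_measurableSet)
    fun _ => MeasurableSet.univ

section CondIID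

variable {Ω S T : Type*} [MeasurableSpace Ω] [MeasurableSpace S] [MeasurableSpace T]

theorem measurable_infinitePi_kernel (κ : Kernel S T) [IsMarkovKernel κ] :
    Measurable fun s => Measure.infinitePi fun _ : ℕ => κ s := by
  refine Measurable.measure_of_isPiSystem_of_isProbabilityMeasure
    generateFrom_squareCylinders.symm isPiSystem_squareCylinders_measurableSet ?_
  rintro _ ⟨I, t, ht, rfl⟩
  have ht' : ∀ i, MeasurableSet (t i) := fun i => ht i trivial
  simp only [Measure.infinitePi_pi _ fun i _ => ht' i]
  exact Finset.measurable_fun_prod _ fun i _ => κ.measurable_coe (ht' i)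

/-- The kernel of i.i.d. sequences with a given law. -/
def iidKernel (κ : Kernel S T) [IsMarkovKernel κ] : Kernel S (ℕ → T) :=
  ⟨fun s => Measure.infinitePi fun _ => κ s, measurable_infinitePi_kernel κ⟩

instance instIsMarkovKernelIidKernel (κ : Kernel S T) [IsMarkovKernel κ] :
    IsMarkovKernel (iidKernel κ) :=
  ⟨fun s => inferInstanceAs (IsProbabilityMeasure (Measure.infinitePi fun _ => κ s))⟩

/-- The definition only tests finite boxes. For fixed `A`, both sides are finite measures in the
sequence, and cylinders form a generating π-system. -/
theorem IsCondIID.map_prodMk {P : Measure Ω} [IsProbabilityMeasure P] {Y : Ω → S}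
    {X : Ω → ℕ → T} {κ : Kernel S T} [IsMarkovKernel κ] (h : IsCondIID P Y X κ)
    (hY : Measurable Y) (hX : Measurable X) :
    P.map (fun ω => (Y ω, X ω)) = (P.map Y) ⊗ₘ (iidKernel κ) := by
  refine Measure.ext_prod fun {A B} hA hB => ?_
  rw [Measure.map_apply (hY.prodMk hX) (hA.prod hB), Measure.compProd_apply_prod hA hB,
    setLIntegral_map hA ((iidKernel κ).measurable_coe hB) hY]
  have hm : Measurable fun ω => iidKernel κ (Y ω) := (iidKernel κ).measurable.comp hY
  have key : (P.restrict (Y ⁻¹' A)).map X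
      = (P.restrict (Y ⁻¹' A)).bind (fun ω => iidKernel κ (Y ω)) := by
    have hval : ∀ B, MeasurableSet B → ((P.restrict (Y ⁻¹' A)).map X) B
        = P {ω | Y ω ∈ A ∧ X ω ∈ B} := by
      intro B hB
      rw [Measure.map_apply hX hB, Measure.restrict_apply (hX hB), Set.inter_comm]
      rfl
    refine ext_of_generate_finite _ generateFrom_squareCylinders.symm
      isPiSystem_squareCylinders_measurableSet ?_ ?_
    · rintro _ ⟨I, t, ht, rfl⟩
      classical
      have ht' : ∀ i, MeasurableSet (t i) := fun i => ht i trivial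
      have hpi : MeasurableSet ((I : Set ℕ).pi t) :=
        MeasurableSet.pi I.countable_toSet fun i _ => ht' i
      -- A cylinder over `I` becomes a box over the first N coordinates, with the whole space as
      -- missing sides.
      obtain ⟨N, hN⟩ : ∃ N, ∀ i ∈ I, i < N :=
        ⟨I.sup id + 1, fun i hi => Nat.lt_succ_of_le (Finset.le_sup (f := id) hi)⟩
      have hiid := h A N (fun k => if (k : ℕ) ∈ I then t k else Set.univ) hA fun k => by
        split_ifs
        · exact ht' k
        · exact MeasurableSet.univ
      rw [hval _ hpi, Measure.bind_apply hpi hm.aemeasurable]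
      have hset : {ω | Y ω ∈ A ∧ X ω ∈ (I : Set ℕ).pi t} = {ω | Y ω ∈ A ∧
          ∀ k : Fin N, X ω k ∈ if (k : ℕ) ∈ I then t k else Set.univ} := by
        ext ω
        refine and_congr_right fun _ => ⟨fun hω k => ?_, fun hω i hi => ?_⟩
        · split_ifs with hk
          · exact hω k hk
          · trivial
        · have := hω ⟨i, hN i hi⟩
          rwa [if_pos (by exact hi)] at this
      rw [hset, hiid]
      refine lintegral_congr fun ω => ?_
      change _ = Measure.infinitePi (fun _ => κ (Y ω)) ((I : Set ℕ).pi t)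
      rw [Measure.infinitePi_pi _ fun i _ => ht' i,
        Fin.prod_univ_eq_prod_range (fun k => κ (Y ω) (if k ∈ I then t k else Set.univ)) N]
      rw [← Finset.prod_subset (s₁ := I) fun i hi => Finset.mem_range.mpr (hN i hi)]
      · exact Finset.prod_congr rfl fun i hi => by rw [if_pos hi]
      · intro i _ hi
        rw [if_neg hi, measure_univ]
    · rw [hval _ MeasurableSet.univ, Measure.bind_apply MeasurableSet.univ hm.aemeasurable]
      simp
      rfl
  have hB' := congrArg (fun ν => ν B) key
  rw [Measure.map_apply hX hB, Measure.restrict_apply (hX hB),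
    Measure.bind_apply hB hm.aemeasurable] at hB'
  rw [← hB', Set.inter_comm]
  rfl

/-- Allows `Y` to be frozen, reducing joint events to i.i.d. points on circles of deterministic
perimeters. -/
theorem IsCondIID.measure_eq {P : Measure Ω} [IsProbabilityMeasure P] {Y : Ω → S}
    {X : Ω → ℕ → T} {κ : Kernel S T} [IsMarkovKernel κ] (h : IsCondIID P Y X κ)
    (hY : Measurable Y) (hX : Measurable X) {D : Set (S × (ℕ → T))} (hD : MeasurableSet D) :
    P {ω | (Y ω, X ω) ∈ D}
      = ∫⁻ ω, Measure.infinitePi (fun _ => κ (Y ω)) {x | (Y ω, x) ∈ D} ∂P := by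
  have h1 := congrArg (fun ν => ν D) (h.map_prodMk hY hX)
  rw [Measure.map_apply (hY.prodMk hX) hD, Measure.compProd_apply hD,
    lintegral_map (Kernel.measurable_kernel_prodMk_left hD) hY] at h1
  exact h1

end CondIID

/-! ### Laws of virtual permutations -/

theorem Measure.ext_of_initial_segments {ρ ν : Measure ((j : ℕ) → Fin (j + 1))}
    [IsProbabilityMeasure ρ] [IsProbabilityMeasure ν]
    (h : ∀ (m : (j : ℕ) → Fin (j + 1)) (N : ℕ),
      ρ {y | ∀ j < N, y j = m j} = ν {y | ∀ j < N, y j = m j}) : ρ = ν := by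
  have hr : ∀ N : ℕ, Measurable fun (y : (j : ℕ) → Fin (j + 1)) (j : Fin N) => y j := fun N => by
    fun_prop
  have hmap : ∀ N : ℕ, ρ.map (fun y (j : Fin N) => y j) = ν.map (fun y (j : Fin N) => y j) := by
    intro N
    refine Measure.ext_of_singleton fun z => ?_
    rw [Measure.map_apply (hr N) (measurableSet_singleton z),
      Measure.map_apply (hr N) (measurableSet_singleton z)]
    have hz : (fun (y : (j : ℕ) → Fin (j + 1)) (j : Fin N) => y j) ⁻¹' {z}
        = {y | ∀ j < N, y j = if h : j < N then z ⟨j, h⟩ else 0} := by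
      ext y
      constructor
      · rintro rfl j hj
        rw [dif_pos hj]
      · intro hy
        ext1 j
        have := hy j j.isLt
        rwa [dif_pos j.isLt] at this
    rw [hz]
    exact h _ N
  refine ext_of_generate_finite _ generateFrom_squareCylinders.symm
    isPiSystem_squareCylinders_measurableSet ?_ (by simp)
  rintro _ ⟨I, t, _, rfl⟩
  obtain ⟨N, hN⟩ : ∃ N, ∀ i ∈ I, i < N :=
    ⟨I.sup id + 1, fun i hi => Nat.lt_succ_of_le (Finset.le_sup (f := id) hi)⟩
  let D : Set ((j : Fin N) → Fin ((j : ℕ) + 1)) := {z | ∀ j : Fin N, (j : ℕ) ∈ I → z j ∈ t j}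
  have hD : (I : Set ℕ).pi t = (fun (y : (j : ℕ) → Fin (j + 1)) (j : Fin N) => y j) ⁻¹' D := by
    ext y
    exact ⟨fun hy j hj => hy j hj, fun hy i hi => hy ⟨i, hN i hi⟩ hi⟩
  have hDm : MeasurableSet D := D.to_countable.measurableSet
  rw [hD, ← Measure.map_apply (hr N) hDm, ← Measure.map_apply (hr N) hDm, hmap]

theorem hasLaw_ewensMeasure_of_chinesePerm {Ω : Type*} [MeasurableSpace Ω] {P : Measure Ω}
    [IsProbabilityMeasure P] {θ : ℝ≥0} {X : Ω → VirtualPermutation} (hX : Measurable X)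
    (h : ∀ (m : (j : ℕ) → Fin (j + 1)) (N : ℕ), P {ω | (X ω).1 N = chinesePerm m N}
      = ∏ j ∈ Finset.range N, (ewensStep θ j).toMeasure {m j}) :
    HasLaw X (ewensMeasure θ) P := by
  refine ⟨hX.aemeasurable, ?_⟩
  have hp := measurable_chineseParam.comp hX
  have hprob : IsProbabilityMeasure (P.map (chineseParam ∘ X)) :=
    Measure.isProbabilityMeasure_map hp.aemeasurable
  have hlaw : P.map (chineseParam ∘ X) = Measure.infinitePi fun j => (ewensStep θ j).toMeasure := by
    refine Measure.ext_of_initial_segments fun m N => ?_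
    have hset : {y : (j : ℕ) → Fin (j + 1) | ∀ j < N, y j = m j}
        = (Finset.range N : Set ℕ).pi fun j => {m j} := by
      ext y
      simp [Set.mem_pi]
    rw [hset, Measure.infinitePi_pi _ fun _ _ => measurableSet_singleton _, ← h m N, ← hset,
      Measure.map_apply hp (hset ▸ MeasurableSet.pi (Finset.countable_toSet _)
        fun _ _ => measurableSet_singleton _)]
    simp only [apply_eq_chinesePerm_iff]
    rfl
  rw [ewensMeasure, ← hlaw, Measure.map_map measurable_chineseVirtual hp]
  congr 1
  ext1 ω
  exact (chineseVirtual_chineseParam (X ω)).symm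

/-- The first step is deterministic and opens the first cycle without weight, whence both
subtractions of 1. For N = 0, truncated subtraction gives the empty product. -/
theorem prod_ewensStep (θ : ℝ≥0) (m : (j : ℕ) → Fin (j + 1)) (N : ℕ) :
    ∏ j ∈ Finset.range N, (ewensStep θ j).toMeasure {m j}
      = ENNReal.ofReal ((θ : ℝ) ^ ((cycleRoots m N).card - 1)
          / risingFactorial (θ + 1) (N - 1)) := by
  have hpmf : ∀ j, (ewensStep θ j).toMeasure {m j} = ewensStep θ j (m j) := fun j =>
    PMF.toMeasure_apply_singleton _ _ (measurableSet_singleton _)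
  have hroot : ∀ N, 0 < (cycleRoots m (N + 1)).card := fun N =>
    Finset.card_pos.mpr ⟨_, cycleRoot_mem_cycleRoots (Nat.succ_pos N)⟩
  simp only [hpmf]
  induction N with
  | zero => simp [cycleRoots, risingFactorial]
  | succ N ih =>
    rw [Finset.prod_range_succ, ih]
    cases N with
    | zero =>
      have h0 : m 0 = Fin.last 0 := Subsingleton.elim (α := Fin 1) _ _
      simp [ewensStep, cycleRoots, risingFactorial, Finset.filter_singleton, h0]
    | succ N =>
      have hr : 0 < risingFactorial ((θ : ℝ) + 1) N := risingFactorial_pos (by positivity) N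
      have hstep : ewensStep θ (N + 1) (m (N + 1)) = ENNReal.ofReal
          ((if m (N + 1) = Fin.last (N + 1) then (θ : ℝ) else 1) / (θ + (N + 1))) := by
        rw [ewensStep, PMF.ofFintype_apply, ← ENNReal.ofReal_coe_nnreal]
        congr 1
        push_cast
        split_ifs <;> rfl
      have hpow : (θ : ℝ) ^ ((cycleRoots m (N + 1 + 1)).card - 1)
          = θ ^ ((cycleRoots m (N + 1)).card - 1)
            * (if m (N + 1) = Fin.last (N + 1) then (θ : ℝ) else 1) := by
        rw [cycleRoots_succ (N + 1)]
        split_ifs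
        · rw [Finset.card_insert_of_notMem (notMem_cycleRoots_self _), ← pow_succ]
          have := hroot N
          congr 1
          omega
        · rw [mul_one]
      rw [hstep, ← ENNReal.ofReal_mul (by positivity), hpow]
      congr 1
      simp only [Nat.add_sub_cancel]
      rw [risingFactorial_succ]
      have : (0 : ℝ) < θ + (N + 1) := by positivity
      field_simp
      ring

theorem circleVirtual_of_distinct {l : ℕ → ℝ} {x : ℕ → ℕ × ℝ} (h : DistinctOnCircles l x) :
    circleVirtual l x = ⟨h.perm, h.removeLast_perm⟩ :=
  dif_pos h

theorem measurableSet_forall_isNextPoint {N : ℕ} (σ : Equiv.Perm (Fin N)) :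
    MeasurableSet {p : (ℕ → ℝ) × (ℕ → ℕ × ℝ) | ∀ k : Fin N, IsNextPoint p.1 p.2 k (σ k)} := by
  simp only [Set.ofPred_forall]
  exact MeasurableSet.iInter fun k => measurableSet_isNextPoint k (σ k)

theorem measurable_circleVirtual :
    Measurable fun p : (ℕ → ℝ) × (ℕ → ℕ × ℝ) => circleVirtual p.1 p.2 := by
  refine Measurable.subtype_mk (f := fun p : (ℕ → ℝ) × (ℕ → ℕ × ℝ) => (circleVirtual p.1 p.2).1)
    (measurable_pi_lambda _ fun N => measurable_to_countable' fun σ => ?_)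
  have hset : (fun p : (ℕ → ℝ) × (ℕ → ℕ × ℝ) => (circleVirtual p.1 p.2).1 N) ⁻¹' {σ}
      = {p | DistinctOnCircles p.1 p.2}.ite {p | ∀ k : Fin N, IsNextPoint p.1 p.2 k (σ k)}
        {_p | (chineseVirtual Fin.last).1 N = σ} := by
    ext p
    by_cases h : DistinctOnCircles p.1 p.2
    · simp [Set.ite, h, circleVirtual_of_distinct h, h.perm_eq_iff]
    · simp [Set.ite, h, circleVirtual]
  rw [hset]
  exact measurableSet_distinctOnCircles.ite (measurableSet_forall_isNextPoint σ)
    (MeasurableSet.const _)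

end

/-! ### The law of the virtual permutation of points on Poisson–Dirichlet circles. -/

theorem proposition2p1 {Ω : Type*} [MeasurableSpace Ω] (P : Measure Ω) [IsProbabilityMeasure P]
    (θ : ℝ≥0) (lam : Ω → ℕ → ℝ) (x : Ω → ℕ → ℕ × ℝ) (κ : Kernel (ℕ → ℝ) (ℕ × ℝ))
    [IsMarkovKernel κ] (hlam : Measurable lam) (hx : Measurable x)
    (hPD : HasLaw lam (poissonDirichlet θ) P)
    (hiid : IsCondIID P lam x κ)
    (hac : ∀ᵐ ω ∂P, κ (lam ω) ≪ circleLebesgue (lam ω))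
    (hmass : ∀ᵐ ω ∂P, ∀ j, κ (lam ω) (circleSet (lam ω) j) = ENNReal.ofReal (lam ω j)) :
    (∀ᵐ ω ∂P, DistinctOnCircles (lam ω) (x ω)) ∧
      HasLaw (fun ω => circleVirtual (lam ω) (x ω)) (ewensMeasure θ) P := by
  have hgood : ∀ᵐ ω ∂P, DistinctOnCircles (lam ω) (x ω) := by
    have h := hiid.measure_eq hlam hx measurableSet_distinctOnCircles.compl
    rw [ae_iff]
    refine h.trans ?_
    rw [← lintegral_zero (μ := P)]
    refine lintegral_congr_ae ?_
    filter_upwards [hac] with ω hω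
    exact ae_iff.mp (ae_distinctOnCircles hω)
  refine ⟨hgood, hasLaw_ewensMeasure_of_chinesePerm
    (measurable_circleVirtual.comp (hlam.prodMk hx)) fun m N => ?_⟩
  set S : (ℕ → ℝ) → ℝ≥0∞ := fun l =>
    distinctSum (cycleRoots m N) (cycleSize m N) fun c => ENNReal.ofReal (l c) with hS
  have hSm : Measurable S := measurable_distinctSum_ofReal _ _
  have h1 : P {ω | (circleVirtual (lam ω) (x ω)).1 N = chinesePerm m N}
      = P {ω | (lam ω, x ω) ∈ {p : (ℕ → ℝ) × (ℕ → ℕ × ℝ) |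
          ∀ k : Fin N, IsNextPoint p.1 p.2 k (chinesePerm m N k)}} := by
    refine measure_congr ?_
    filter_upwards [hgood] with ω hω
    refine propext ?_
    change (circleVirtual (lam ω) (x ω)).1 N = chinesePerm m N ↔
      ∀ k : Fin N, IsNextPoint (lam ω) (x ω) k (chinesePerm m N k)
    rw [circleVirtual_of_distinct hω]
    exact hω.perm_eq_iff
  have h2 : ∫⁻ ω, Measure.infinitePi (fun _ => κ (lam ω)) {y | (lam ω, y) ∈
        {p : (ℕ → ℝ) × (ℕ → ℕ × ℝ) |
          ∀ k : Fin N, IsNextPoint p.1 p.2 k (chinesePerm m N k)}} ∂P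
      = ∫⁻ ω, S (lam ω) / cycleArrangements m N ∂P := by
    refine lintegral_congr_ae ?_
    filter_upwards [hac, hmass] with ω hω hω'
    exact measure_isNextPoint_chinesePerm hω hω' m N
  rw [h1, hiid.measure_eq hlam hx (measurableSet_forall_isNextPoint _), h2, prod_ewensStep]
  -- The Poisson–Dirichlet moment requires at least one cycle, so N = 0 is treated apart.
  cases N with
  | zero => simp [hS, cycleRoots, cycleArrangements, distinctSum_empty, risingFactorial]
  | succ N =>
    have hc : (0 : ℝ) < cycleArrangements m (N + 1) := by
      exact_mod_cast Nat.pos_of_ne_zero (cycleArrangements_ne_zero (m := m) (N + 1))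
    simp only [div_eq_mul_inv]
    rw [lintegral_mul_const (f := fun ω => S (lam ω)) _ (hSm.comp hlam), ← lintegral_map hSm hlam,
      hPD.map_eq, hS,
      lintegral_distinctSum_poissonDirichlet θ
        ⟨_, cycleRoot_mem_cycleRoots (Nat.succ_pos N)⟩ fun q hq => cycleSize_ne_zero hq,
      sum_cycleSize, ← div_eq_mul_inv, ← ENNReal.ofReal_natCast,
      ← ENNReal.ofReal_div_of_pos hc]
    congr 1
    -- The factorials in the moment form `cycleArrangements`, which cancels the number of equally
    -- likely arrangements.
    rw [← Nat.cast_prod]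
    change _ * (cycleArrangements m (N + 1) : ℝ) / _ / _ = _
    have hr : 0 < risingFactorial ((θ : ℝ) + 1) (N + 1 - 1) := risingFactorial_pos (by positivity) _
    field_simp
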